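/- Let $\mathbb{T}$ be the unit circle with normalized Lebesgue measure, $H^2$ the closed subspace of $L^2(\mathbb{T})$ with orthonormal basis $e_n(z)=z^n$, $n\ge 0$, and $P:L^2(\mathbb{T})\to H^2$ the orthogonal projection. For a measurable function $\omega$ on $\mathbb{T}$ the Toeplitz operator $T_\omega$ in $H^2$ is $T_\omega u=P(\omega u)$ on $\operatorname{dom}T_\omega=\{u\in H^2:\omega u\in L^2(\mathbb{T})\}$. For a polynomial $S\neq0$ with complex coefficients write $S=s\,S_{in}\,S_{ex}$, where the zeros of $s$, $S_{in}$, $S_{ex}$ are the zeros of $S$ (with multiplicity) of modulus $=1$, $<1$, $>1$, respectively. Let $\breve S$ denote a nonzero polynomial whose zeros are the numbers $1/\overline b$, with the same multiplicity as $b$, for the zeros $b\ne0$ of $S$; write $\breve S_{ex}$ for $(\breve S)_{ex}$. These polynomials are determined up to nonzero constant factors. The zero polynomial is regarded as the only polynomial of negative degree. Let $\omega=R/S$ with complex polynomials $R$, $S$, $S\ne 0$, without common zeros, and suppose that $\omega$ is real-valued on $\mathbb{T}$ (outside the zeros of $S$). Then $T_\omega$ is densely defined, closed and symmetric, with $\operatorname{dom}T_\omega=sH^2$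 and $\operatorname{ran}T_\omega=P\big(\tfrac{R}{S_{in}S_{ex}}H^2\big)$. Moreover there are polynomials $p,q$ with $$R-\mathrm{i}S=p\,q,$$ where all zeros of $p$ have modulus $<1$ and all zeros of $q$ have modulus $>1$. For any such $p,q$ put $l:=\deg(R+\mathrm{i}S)-\deg\breve p-\deg\breve q$. Then the deficiency indices are finite and equal $$n_+:=\dim\operatorname{ran}(T_\omega-\mathrm{i}I)^\perp=\deg p-\deg S_{in},\qquad n_-:=\dim\operatorname{ran}(T_\omega+\mathrm{i}I)^\perp=l+\deg q-\deg S_{in},$$ and the deficiency spaces are $$\operatorname{ran}(T_\omega-\mathrm{i}I)^\perp=\Big\{\frac{\breve S_{ex}}{\breve p}\,t:\ t\text{ a polynomial with }\deg t<n_+\Big\},$$ $$\operatorname{ran}(T_\omega+\mathrm{i}I)^\perp=\Big\{\frac{\breve S_{ex}}{q}\,t:\ t\text{ a polynomial with }\deg t<n_-\Big\}.$$ -/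

import Mathlib

open MeasureTheory Polynomial

namespace RationalToeplitz

noncomputable section

/-! The torus is parametrised as `ℝ/ℤ` by `t ↦ z = exp (2πit)`; its normalized Lebesgue measure is
`AddCircle.haarAddCircle`. -/

/-- The space `L²` of the torus with its normalized Lebesgue measure. -/
abbrev L2T : Type := Lp ℂ 2 (AddCircle.haarAddCircle : Measure UnitAddCircle)

/-- The point `z = exp (2πit)` of the unit circle with parameter `t`. -/
def pt (t : UnitAddCircle) : ℂ := (AddCircle.toCircle t : ℂ)

/-- The Hardy space `H²`: the closed span in `L²` of the orthonormal functions `e_n(z) = z^n`,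
`n = 0, 1, 2, …`. -/
def hardy : Submodule ℂ L2T :=
  (Submodule.span ℂ (Set.range fun n : ℕ => (fourierLp 2 (n : ℤ) : L2T))).topologicalClosure

instance : CompleteSpace hardy :=
  (Submodule.isClosed_topologicalClosure _).completeSpace_coe

/-- The domain `{u ∈ H² : ω u ∈ L²}` of the Toeplitz operator with symbol `ω`. -/
def toeplitzDomain (ω : UnitAddCircle → ℂ) : Submodule ℂ hardy where
  carrier := {u | MemLp (fun t => ω t * (u : L2T) t) 2 AddCircle.haarAddCircle}
  zero_mem' := by
    refine (MemLp.zero' (ε := ℂ)).ae_eq ?_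
    filter_upwards [Lp.coeFn_zero ℂ 2 (AddCircle.haarAddCircle : Measure UnitAddCircle)] with t ht
    have h0 : (((0 : hardy) : L2T) : UnitAddCircle → ℂ) t = 0 := ht
    rw [h0, mul_zero]
  add_mem' {u v} hu hv := by
    refine (MemLp.add hu hv).ae_eq ?_
    filter_upwards [Lp.coeFn_add (u : L2T) (v : L2T)] with t ht
    have h0 : (((u + v : hardy) : L2T) : UnitAddCircle → ℂ) t = (u : L2T) t + (v : L2T) t := ht
    rw [h0, mul_add, Pi.add_apply]
  smul_mem' c u hu := by
    refine (MemLp.const_smul hu c).ae_eq ?_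
    filter_upwards [Lp.coeFn_smul c (u : L2T)] with t ht
    have h0 : (((c • u : hardy) : L2T) : UnitAddCircle → ℂ) t = c * (u : L2T) t := ht
    rw [h0, Pi.smul_apply, smul_eq_mul, mul_left_comm]

theorem mem_toeplitzDomain {ω : UnitAddCircle → ℂ} {u : hardy} :
    u ∈ toeplitzDomain ω ↔ MemLp (fun t => ω t * (u : L2T) t) 2 AddCircle.haarAddCircle :=
  Iff.rfl

/-- The operator `u ↦ ω u` from `{u ∈ H² : ω u ∈ L²}` to `L²`. -/
def mulSymbol (ω : UnitAddCircle → ℂ) : toeplitzDomain ω →ₗ[ℂ] L2T where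
  toFun u := MemLp.toLp (fun t => ω t * ((u : hardy) : L2T) t) (mem_toeplitzDomain.1 u.2)
  map_add' u v := by
    refine Eq.trans ?_ (MemLp.toLp_add (mem_toeplitzDomain.1 u.2) (mem_toeplitzDomain.1 v.2))
    refine MemLp.toLp_congr _ _ ?_
    filter_upwards [Lp.coeFn_add ((u : hardy) : L2T) ((v : hardy) : L2T)] with t ht
    have h0 : ((((u + v : toeplitzDomain ω) : hardy) : L2T) : UnitAddCircle → ℂ) t
      = ((u : hardy) : L2T) t + ((v : hardy) : L2T) t := ht
    rw [h0, mul_add, Pi.add_apply]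
  map_smul' c u := by
    refine Eq.trans ?_ (MemLp.toLp_const_smul c (mem_toeplitzDomain.1 u.2))
    refine MemLp.toLp_congr _ _ ?_
    filter_upwards [Lp.coeFn_smul c ((u : hardy) : L2T)] with t ht
    have h0 : ((((c • u : toeplitzDomain ω) : hardy) : L2T) : UnitAddCircle → ℂ) t
      = c * ((u : hardy) : L2T) t := ht
    rw [h0, Pi.smul_apply, smul_eq_mul, mul_left_comm]

/-- The Toeplitz operator `T_ω u = P (ω u)` in `H²`, where `P` is the orthogonal projection of `L²`
onto `H²`, with domain `{u ∈ H² : ω u ∈ L²}`. -/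
def toeplitz (ω : UnitAddCircle → ℂ) : hardy →ₗ.[ℂ] hardy where
  domain := toeplitzDomain ω
  toFun := (hardy.orthogonalProjectionOnto : L2T →ₗ[ℂ] hardy) ∘ₗ mulSymbol ω

/-- The range of `T - c I`, for an operator `T` in `H²`. -/
def ranSub (T : hardy →ₗ.[ℂ] hardy) (c : ℂ) : Submodule ℂ hardy :=
  LinearMap.range (T.toFun - c • T.domain.subtype)

/-- The restriction to the torus of the rational function `R / S`. -/
def ratFun (R S : ℂ[X]) (t : UnitAddCircle) : ℂ := R.eval (pt t) / S.eval (pt t)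

/-- The subspace `K` of `H²` is the set `F` of functions on the torus
(up to equality almost everywhere). In particular all functions in `F` represent elements of `H²`. -/
def ConsistsOf (K : Submodule ℂ hardy) (F : Set (UnitAddCircle → ℂ)) : Prop :=
  (∀ v ∈ K, ∃ f ∈ F, ((v : L2T) : UnitAddCircle → ℂ) =ᵐ[AddCircle.haarAddCircle] f) ∧
  ∀ f ∈ F, ∃ v ∈ K, ((v : L2T) : UnitAddCircle → ℂ) =ᵐ[AddCircle.haarAddCircle] f

/-- `S_in`: the monic polynomial formed with the zeros of `S` of modulus `< 1`. -/
def inPart (S : ℂ[X]) : ℂ[X] := ((S.roots.filter (‖·‖ < 1)).map fun b => X - C b).prod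

/-- `S_ex`: the monic polynomial formed with the zeros of `S` of modulus `> 1`. -/
def exPart (S : ℂ[X]) : ℂ[X] := ((S.roots.filter (1 < ‖·‖)).map fun b => X - C b).prod

/-- `s`: the polynomial formed with the zeros of `S` of modulus `1`, carrying the leading
coefficient of `S`, so that `S = s * S_in * S_ex`. -/
def circlePart (S : ℂ[X]) : ℂ[X] :=
  C S.leadingCoeff * ((S.roots.filter (‖·‖ = 1)).map fun b => X - C b).prod

theorem circlePart_mul_inPart_mul_exPart (S : ℂ[X]) :
    circlePart S * inPart S * exPart S = S := by
  have h1 : S.roots.filter (‖·‖ = 1) + S.roots.filter (‖·‖ < 1) + S.roots.filter (1 < ‖·‖)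
      = S.roots := by
    ext b
    simp only [Multiset.count_add, Multiset.count_filter]
    rcases lt_trichotomy ‖b‖ 1 with h | h | h
    · simp [h, h.ne, h.not_gt]
    · simp [h]
    · simp [h, h.ne', h.not_gt]
  have h2 := (IsAlgClosed.splits S).eq_prod_roots
  conv_rhs => rw [h2, ← h1]
  simp only [circlePart, inPart, exPart, Multiset.map_add, Multiset.prod_add, mul_assoc]

/-- The reflected polynomial: the monic polynomial whose zeros are `1 / conj b`, with the same
multiplicity as `b`, for the zeros `b ≠ 0` of `S`. -/
def breve (S : ℂ[X]) : ℂ[X] :=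
  ((S.roots.filter (· ≠ 0)).map fun b => X - C (starRingEnd ℂ b)⁻¹).prod

/-- The set of the functions `A t / B` on the torus, for polynomials `t` with `deg t < n`, where the
zero polynomial is the only polynomial of negative degree. -/
def polyMultiples (A B : ℂ[X]) (n : ℤ) : Set (UnitAddCircle → ℂ) :=
  {f | ∃ t : ℂ[X], (t = 0 ∨ (t.natDegree : ℤ) < n) ∧ f = ratFun (A * t) B}

/-- `R - iS = p q`, where all zeros of `p` have modulus `< 1` and all zeros of `q` have
modulus `> 1`. -/
def IsFactorization (R S p q : ℂ[X]) : Prop :=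
  R - C Complex.I * S = p * q ∧ (∀ z, p.IsRoot z → ‖z‖ < 1) ∧ ∀ z, q.IsRoot z → 1 < ‖z‖

end

end RationalToeplitz

open RationalToeplitz

namespace RationalToeplitz

/-! Everything is read off Fourier coefficients: `H²` is the set of `L²` functions without
coefficients at negative indices, and `P` keeps the others. The main tool is division by linear
factors: a divisor without zeros in the open disc preserves vanishing below a given index
(`fourierCoeff_eq_zero_of_pmul_low`), and a divisor with all zeros in the closed disc lowers an
upper bound of the spectrum by its degree (`fourierCoeff_eq_zero_of_pmul_high`). Zeros on the circle
are allowed in both.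

A Bézout identity for `R` and `s` gives `dom T = s H²` (`mem_domain_iff`). On it the factor `s`
cancels: `(T - c)(s h)` is the Toeplitz operator with bounded symbol `(R - cS)/(S_in S_ex)` applied
to `h` (`toeplitz_sub_smul_eq`), so only ranges of bounded Toeplitz operators have to be studied.
Closedness holds because the graph is described by `Ru - Sy` lying in a finite-dimensional space
(`mem_graph_toeplitz_iff`).

If `R - iS = p q`, then `v` is orthogonal to the range exactly when `(p q/(S_in S_ex)) conj v` has
no coefficients at indices `≤ 0`. The factor `q/S_ex` does not affect this, and `(p/S_in) conj v`
has none above `deg p - deg S_in`. It is thus `z` times a polynomial, and conjugation on the circle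
gives the formula for `v` (`mem_orthogonal_range_toeplitz_iff_exists`). The inequality `deg S_in ≤
deg p` holds because a symmetric operator has no nonreal eigenvalues (`natDegree_inPart_le`).

For `-i`, realness of `ω` makes `R + iS` the reflection of `R - iS` up to a factor `c z^m`
(`exists_add_I_mul_eq`). Hence `R + iS = (c z^m q˘) p˘` is a factorization of the same kind, with `m
= l`, and the same result applies. -/

/-! ### Polynomials on the circle as multipliers of `L²`. -/

/-- The normalized Lebesgue measure of the torus. -/
noncomputable abbrev haar : Measure UnitAddCircle := AddCircle.haarAddCircle

/-- The product of a polynomial and a function on the torus. -/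
noncomputable def pmul (P : ℂ[X]) (f : UnitAddCircle → ℂ) (t : UnitAddCircle) : ℂ :=
  P.eval (pt t) * f t

theorem norm_pt (t : UnitAddCircle) : ‖pt t‖ = 1 := Circle.norm_coe _

theorem pt_ne_zero (t : UnitAddCircle) : pt t ≠ 0 := Circle.coe_ne_zero _

theorem conj_pt (t : UnitAddCircle) : starRingEnd ℂ (pt t) = (pt t)⁻¹ :=
  (Circle.coe_inv_eq_conj _).symm

theorem continuous_pt : Continuous pt :=
  continuous_subtype_val.comp AddCircle.continuous_toCircle

theorem injective_pt : Function.Injective pt :=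
  Subtype.coe_injective.comp (AddCircle.injective_toCircle one_ne_zero)

theorem exists_pt_eq {z : ℂ} (hz : ‖z‖ = 1) : ∃ t, pt t = z := by
  obtain ⟨t, ht⟩ := (AddCircle.homeomorphCircle (T := 1) one_ne_zero).surjective
    ⟨z, mem_sphere_zero_iff_norm.2 hz⟩
  refine ⟨t, ?_⟩
  rw [AddCircle.homeomorphCircle_apply] at ht
  simp [pt, ht]

instance : Nontrivial UnitAddCircle := by
  obtain ⟨t, ht⟩ := exists_pt_eq (z := 1) (by simp)
  obtain ⟨t', ht'⟩ := exists_pt_eq (z := -1) (by simp)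
  refine ⟨t, t', fun h => ?_⟩
  rw [h, ht'] at ht
  norm_num at ht

theorem fourier_eq_zpow (n : ℤ) (t : UnitAddCircle) : fourier n t = pt t ^ n := by
  rw [fourier_apply, AddCircle.toCircle_zsmul, Circle.coe_zpow, pt]

theorem continuous_eval_pt (P : ℂ[X]) : Continuous fun t => P.eval (pt t) :=
  P.continuous.comp continuous_pt

theorem ae_eval_pt_ne_zero {P : ℂ[X]} (hP : P ≠ 0) : ∀ᵐ t ∂haar, P.eval (pt t) ≠ 0 := by
  have h : {t : UnitAddCircle | ¬ P.eval (pt t) ≠ 0}.Finite := by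
    refine Set.Finite.subset
      (Set.Finite.preimage injective_pt.injOn (P.roots.toFinset.finite_toSet)) ?_
    intro t ht
    simpa [hP] using ht
  exact h.measure_zero _

theorem infinite_range_pt : (Set.range pt).Infinite := by
  have : Infinite UnitAddCircle := PreconnectedSpace.infinite
  exact Set.infinite_range_of_injective injective_pt

theorem memLp_continuous_mul {f g : UnitAddCircle → ℂ} (hf : MemLp f 2 haar)
    (hg : Continuous g) : MemLp (fun t => g t * f t) 2 haar := by
  obtain ⟨C, hC⟩ := isCompact_univ.exists_bound_of_continuousOn hg.continuousOn
  refine hf.of_le_mul (c := C) (hg.aestronglyMeasurable.mul hf.1) (ae_of_all _ fun t => ?_)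
  rw [norm_mul]
  exact mul_le_mul_of_nonneg_right (hC t trivial) (norm_nonneg _)

theorem memLp_pmul (P : ℂ[X]) {f : UnitAddCircle → ℂ} (hf : MemLp f 2 haar) :
    MemLp (pmul P f) 2 haar :=
  memLp_continuous_mul hf (continuous_eval_pt P)

theorem memLp_continuous {g : UnitAddCircle → ℂ} (hg : Continuous g) : MemLp g 2 haar := by
  simpa using memLp_continuous_mul (memLp_const (1 : ℂ)) hg

theorem memLp_div {P : ℂ[X]} (hP : ∀ z, P.IsRoot z → ‖z‖ ≠ 1) {f : UnitAddCircle → ℂ}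
    (hf : MemLp f 2 haar) : MemLp (fun t => f t / P.eval (pt t)) 2 haar := by
  have h := memLp_continuous_mul hf
    ((continuous_eval_pt P).inv₀ fun t ht => hP _ ht (norm_pt t))
  exact h.ae_eq (ae_of_all _ fun t => (div_eq_inv_mul _ _).symm)

theorem pmul_mul (P Q : ℂ[X]) (f : UnitAddCircle → ℂ) : pmul (P * Q) f = pmul P (pmul Q f) := by
  funext t
  simp only [pmul, eval_mul, mul_assoc]

theorem pmul_congr_ae (P : ℂ[X]) {f g : UnitAddCircle → ℂ} (h : f =ᵐ[haar] g) :
    pmul P f =ᵐ[haar] pmul P g := by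
  filter_upwards [h] with t ht
  simp only [pmul, ht]

/-! ### Fourier coefficients under multiplication and division by polynomials. -/

theorem fourierCoeff_pt_pow_mul (f : UnitAddCircle → ℂ) (m : ℕ) (n : ℤ) :
    fourierCoeff (fun t => pt t ^ m * f t) n = fourierCoeff f (n - m) := by
  refine integral_congr_ae (ae_of_all _ fun t => ?_)
  simp only [fourier_eq_zpow, smul_eq_mul, neg_sub]
  rw [← mul_assoc, ← zpow_natCast, ← zpow_add₀ (pt_ne_zero t), neg_add_eq_sub]

theorem fourierCoeff_pmul (P : ℂ[X]) {f : UnitAddCircle → ℂ} (hf : MemLp f 2 haar) (n : ℤ) :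
    fourierCoeff (pmul P f) n
      = ∑ i ∈ Finset.range (P.natDegree + 1), P.coeff i * fourierCoeff f (n - i) := by
  have h : pmul P f
      = ∑ i ∈ Finset.range (P.natDegree + 1), fun t => P.coeff i * (pt t ^ i * f t) := by
    funext t
    simp only [pmul, eval_eq_sum_range, Finset.sum_mul, Finset.sum_apply, mul_assoc]
  rw [h, fourierCoeff.sum]
  · simp only [Finset.sum_apply, fourierCoeff.const_mul, fourierCoeff_pt_pow_mul]
  · intro i _
    exact ((memLp_continuous_mul hf (continuous_pt.pow i)).integrable one_le_two).const_mul _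

theorem fourierCoeff_pmul_X_sub_C (b : ℂ) {f : UnitAddCircle → ℂ} (hf : MemLp f 2 haar) (n : ℤ) :
    fourierCoeff (pmul (X - C b) f) n = fourierCoeff f (n - 1) - b * fourierCoeff f n := by
  rw [fourierCoeff_pmul _ hf, natDegree_X_sub_C, Finset.sum_range_succ, Finset.sum_range_one]
  simp
  ring

theorem tendsto_fourierCoeff {f : UnitAddCircle → ℂ} (hf : MemLp f 2 haar) :
    Filter.Tendsto (fourierCoeff f) Filter.cofinite (nhds 0) := by
  have h := (hasSum_sq_fourierCoeff (hf.toLp f)).summable.tendsto_cofinite_zero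
  rw [fourierCoeff_congr_ae hf.coeFn_toLp] at h
  rw [tendsto_zero_iff_norm_tendsto_zero]
  simpa using h.sqrt

/-- The coefficients of an `L²` function tend to zero, so moduli that do not decrease along distinct
indices all vanish. Because equality is allowed, zeros on the circle itself can be divided out. -/
theorem fourierCoeff_eq_zero_of_le_norm {f : UnitAddCircle → ℂ} (hf : MemLp f 2 haar) (a : ℕ → ℤ)
    (ha : Function.Injective a) (h : ∀ j, ‖fourierCoeff f (a j)‖ ≤ ‖fourierCoeff f (a (j + 1))‖) :
    fourierCoeff f (a 0) = 0 := by
  have h1 : Filter.Tendsto (fun j => ‖fourierCoeff f (a j)‖) Filter.atTop (nhds 0) := by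
    rw [← tendsto_zero_iff_norm_tendsto_zero, ← Nat.cofinite_eq_atTop]
    exact (tendsto_fourierCoeff hf).comp ha.tendsto_cofinite
  have h2 := (monotone_nat_of_le_succ h).ge_of_tendsto h1 0
  simpa using h2

theorem induction_on_linear_factors {M : (p : ℂ[X]) → p ≠ 0 → Prop}
    (hC : ∀ (c : ℂ) (hc : c ≠ 0), M (C c) (C_ne_zero.2 hc))
    (hmul : ∀ (b : ℂ) (q : ℂ[X]) (hq : q ≠ 0), M q hq →
      M ((X - C b) * q) (mul_ne_zero (X_sub_C_ne_zero b) hq))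
    (p : ℂ[X]) (hp : p ≠ 0) : M p hp := by
  induction h : p.natDegree generalizing p with
  | zero =>
    rw [natDegree_eq_zero] at h
    obtain ⟨c, rfl⟩ := h
    exact hC c fun hc => hp (by rw [hc, C_0])
  | succ d ih =>
    obtain ⟨b, hb⟩ := IsAlgClosed.exists_root p (by
      rw [degree_eq_natDegree hp, h]; exact_mod_cast d.succ_ne_zero)
    obtain ⟨q, rfl⟩ := dvd_iff_isRoot.2 hb
    have hq : q ≠ 0 := right_ne_zero_of_mul hp
    rw [natDegree_mul (X_sub_C_ne_zero b) hq, natDegree_X_sub_C] at h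
    exact hmul b q hq (ih q hq (by lia))

theorem fourierCoeff_C_mul (c : ℂ) (f : UnitAddCircle → ℂ) (n : ℤ) :
    fourierCoeff (pmul (C c) f) n = c * fourierCoeff f n := by
  rw [← fourierCoeff.const_mul]
  congr 1
  funext t
  rw [pmul, eval_C]

/-- Division by a polynomial without zeros in the open disc preserves vanishing of the low Fourier
coefficients. -/
theorem fourierCoeff_eq_zero_of_pmul_low {q : ℂ[X]} (hq : q ≠ 0) (hr : ∀ z, q.IsRoot z → 1 ≤ ‖z‖)
    {f : UnitAddCircle → ℂ} (hf : MemLp f 2 haar) {N : ℤ}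
    (h : ∀ n < N, fourierCoeff (pmul q f) n = 0) : ∀ n < N, fourierCoeff f n = 0 := by
  induction q, hq using induction_on_linear_factors with
  | hC c hc =>
    intro n hn
    simpa [fourierCoeff_C_mul, hc] using h n hn
  | hmul b q hq ih =>
    have hg := memLp_pmul q hf
    refine ih (fun z hz => hr z (by simp [hz.eq_zero])) ?_
    intro n hn
    rw [pmul_mul] at h
    have hb : 1 ≤ ‖b‖ := hr b (by simp)
    -- A vanishing coefficient of `(z - b) g` at `n - j` says `ĝ(n - j - 1) = b ĝ(n - j)`; since `1
    -- ≤ ‖b‖`, the moduli do not decrease towards `-∞`.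
    refine Eq.trans (by simp)
      (fourierCoeff_eq_zero_of_le_norm hg (fun j => n - j) (fun i j hij => by simpa using hij)
        fun j => ?_)
    have h1 := h (n - j) (by lia)
    rw [fourierCoeff_pmul_X_sub_C _ hg, sub_eq_zero] at h1
    push_cast
    rw [← sub_sub, h1, norm_mul]
    exact le_mul_of_one_le_left (norm_nonneg _) hb

/-- Division by a polynomial without zeros outside the closed disc lowers the order beyond which the
Fourier coefficients vanish by its degree. -/
theorem fourierCoeff_eq_zero_of_pmul_high {q : ℂ[X]} (hq : q ≠ 0)
    (hr : ∀ z, q.IsRoot z → ‖z‖ ≤ 1) {f : UnitAddCircle → ℂ} (hf : MemLp f 2 haar) {N : ℤ}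
    (h : ∀ n ≥ N, fourierCoeff (pmul q f) n = 0) :
    ∀ n ≥ N - q.natDegree, fourierCoeff f n = 0 := by
  induction q, hq using induction_on_linear_factors generalizing N with
  | hC c hc =>
    intro n hn
    rw [natDegree_C] at hn
    simpa [fourierCoeff_C_mul, hc] using h n (by simpa using hn)
  | hmul b q hq ih =>
    have hg := memLp_pmul q hf
    rw [natDegree_mul (X_sub_C_ne_zero b) hq, natDegree_X_sub_C, Nat.cast_add, Nat.cast_one,
      ← sub_sub]
    refine ih (fun z hz => hr z (by simp [hz.eq_zero])) ?_
    intro n hn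
    rw [pmul_mul] at h
    have hb : ‖b‖ ≤ 1 := hr b (by simp)
    refine Eq.trans (by simp)
      (fourierCoeff_eq_zero_of_le_norm hg (fun j => n + j) (fun i j hij => by simpa using hij)
        fun j => ?_)
    -- Here `ĝ(n + j) = b ĝ(n + j + 1)` with `‖b‖ ≤ 1`. The relation already starts at `n = N - 1`,
    -- which is the gain of one index per linear factor.
    have h1 := h (n + j + 1) (by lia)
    rw [fourierCoeff_pmul_X_sub_C _ hg, sub_eq_zero, add_sub_cancel_right] at h1
    push_cast
    rw [← add_assoc, h1, norm_mul]
    exact mul_le_of_le_one_left (norm_nonneg _) hb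

theorem fourierCoeff_pmul_low (q : ℂ[X]) {f : UnitAddCircle → ℂ} (hf : MemLp f 2 haar) {N : ℤ}
    (h : ∀ n < N, fourierCoeff f n = 0) : ∀ n < N, fourierCoeff (pmul q f) n = 0 := by
  intro n hn
  rw [fourierCoeff_pmul q hf]
  exact Finset.sum_eq_zero fun i _ => by rw [h _ (by lia), mul_zero]

theorem fourierCoeff_pmul_high (q : ℂ[X]) {f : UnitAddCircle → ℂ} (hf : MemLp f 2 haar) {N : ℤ}
    (h : ∀ n ≥ N, fourierCoeff f n = 0) :
    ∀ n ≥ N + q.natDegree, fourierCoeff (pmul q f) n = 0 := by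
  intro n hn
  rw [fourierCoeff_pmul q hf]
  refine Finset.sum_eq_zero fun i hi => ?_
  have := Finset.mem_range.1 hi
  rw [h _ (by lia), mul_zero]

theorem ae_eq_of_fourierCoeff_eq {f g : UnitAddCircle → ℂ} (hf : MemLp f 2 haar)
    (hg : MemLp g 2 haar) (h : ∀ n, fourierCoeff f n = fourierCoeff g n) : f =ᵐ[haar] g := by
  rw [← MemLp.toLp_eq_toLp_iff hf hg]
  refine fourierBasis.repr.injective (lp.ext (funext fun n => ?_))
  rw [fourierBasis_repr, fourierBasis_repr, fourierCoeff_congr_ae hf.coeFn_toLp,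
    fourierCoeff_congr_ae hg.coeFn_toLp, h]

theorem fourierCoeff_one (n : ℤ) :
    fourierCoeff (fun _ : UnitAddCircle => (1 : ℂ)) n = if n = 0 then 1 else 0 := by
  have h := fourierBasis_repr (T := 1) (fourierLp 2 0) n
  rw [fourierCoeff_congr_ae (coeFn_fourierLp 2 0)] at h
  have h0 : ⇑(fourier 0 : C(UnitAddCircle, ℂ)) = fun _ => (1 : ℂ) := by
    funext t
    exact fourier_zero
  rw [h0] at h
  rw [← h, ← coe_fourierBasis, HilbertBasis.repr_self, lp.single_apply]
  simp [Pi.single_apply]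

theorem fourierCoeff_eval_pt (P : ℂ[X]) (n : ℤ) :
    fourierCoeff (fun t => P.eval (pt t)) n = if 0 ≤ n then P.coeff n.toNat else 0 := by
  have h : (fun t => P.eval (pt t)) = pmul P fun _ => 1 := by
    funext t
    simp [pmul]
  rw [h, fourierCoeff_pmul P (memLp_const _)]
  simp only [fourierCoeff_one]
  split_ifs with hn
  · lift n to ℕ using hn
    simp only [sub_eq_zero, Nat.cast_inj, mul_ite, mul_one, mul_zero, Finset.sum_ite_eq,
      Finset.mem_range, Int.toNat_natCast]
    split_ifs with h1
    · rfl
    · exact (coeff_eq_zero_of_natDegree_lt (by lia)).symm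
  · exact Finset.sum_eq_zero fun i _ => by rw [if_neg (by lia), mul_zero]

/-- An `L²` function with finitely many nonzero Fourier coefficients, all at nonnegative indices, is
a polynomial. -/
theorem exists_polynomial_of_fourierCoeff {f : UnitAddCircle → ℂ} (hf : MemLp f 2 haar) (d : ℕ)
    (h0 : ∀ n < 0, fourierCoeff f n = 0) (h1 : ∀ n : ℤ, d ≤ n → fourierCoeff f n = 0) :
    ∃ t ∈ degreeLT ℂ d, f =ᵐ[haar] fun x => t.eval (pt x) := by
  refine ⟨∑ i ∈ Finset.range d, C (fourierCoeff f i) * X ^ i, ?_, ?_⟩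
  · refine Submodule.sum_mem _ fun i hi => mem_degreeLT.2 ?_
    exact (degree_C_mul_X_pow_le _ _).trans_lt (by exact_mod_cast Finset.mem_range.1 hi)
  · refine ae_eq_of_fourierCoeff_eq hf (memLp_continuous (continuous_eval_pt _)) fun n => ?_
    rw [fourierCoeff_eval_pt]
    split_ifs with hn
    · lift n to ℕ using hn
      simp only [finsetSum_coeff, coeff_C_mul, coeff_X_pow, Int.toNat_natCast, mul_ite, mul_one,
        mul_zero, Finset.sum_ite_eq, Finset.mem_range]
      split_ifs with h2
      · rfl
      · exact h1 n (by lia)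
    · exact h0 n (by lia)

/-! ### Conjugation, and the Hardy space in terms of Fourier coefficients. -/

open ComplexConjugate in
theorem fourierCoeff_conj (f : UnitAddCircle → ℂ) (n : ℤ) :
    fourierCoeff (fun t => conj (f t)) n = conj (fourierCoeff f (-n)) := by
  rw [fourierCoeff, fourierCoeff, ← integral_conj]
  refine integral_congr_ae (ae_of_all _ fun t => ?_)
  simp only [smul_eq_mul, map_mul, ← fourier_neg, neg_neg]

open ComplexConjugate in
theorem memLp_conj {f : UnitAddCircle → ℂ} (hf : MemLp f 2 haar) :
    MemLp (fun t => conj (f t)) 2 haar :=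
  hf.star

theorem fourierCoeff_eq_inner (u : L2T) (n : ℤ) :
    fourierCoeff u n = inner ℂ (fourierLp 2 n : L2T) u := by
  rw [← fourierBasis_repr, HilbertBasis.repr_apply_apply, coe_fourierBasis]

theorem fourierLp_mem_hardy {n : ℤ} (hn : 0 ≤ n) : (fourierLp 2 n : L2T) ∈ hardy := by
  lift n to ℕ using hn
  exact Submodule.le_topologicalClosure _ (Submodule.subset_span ⟨n, rfl⟩)

theorem hardy_le_of_isClosed {K : Submodule ℂ L2T} (hK : IsClosed (K : Set L2T))
    (h : ∀ n : ℤ, 0 ≤ n → (fourierLp 2 n : L2T) ∈ K) : hardy ≤ K := by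
  refine Submodule.topologicalClosure_minimal _ (Submodule.span_le.2 ?_) hK
  rintro _ ⟨n, rfl⟩
  exact h n (by positivity)

theorem mem_hardy_iff {u : L2T} : u ∈ hardy ↔ ∀ n < 0, fourierCoeff u n = 0 := by
  constructor
  · intro hu n hn
    have h : hardy ≤ (Submodule.span ℂ {(fourierLp 2 n : L2T)})ᗮ := by
      refine hardy_le_of_isClosed (Submodule.isClosed_orthogonal _) fun m hm => ?_
      rw [Submodule.mem_orthogonal_singleton_iff_inner_right]
      exact orthonormal_fourier.2 (by lia)
    rw [fourierCoeff_eq_inner]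
    exact Submodule.mem_orthogonal_singleton_iff_inner_right.1 (h hu)
  · intro h
    refine (Submodule.isClosed_topologicalClosure _).mem_of_tendsto
      (hasSum_fourier_series_L2 u) (Filter.Eventually.of_forall fun s => ?_)
    refine Submodule.sum_mem hardy fun i _ => ?_
    rcases lt_or_ge i 0 with hi | hi
    · rw [h i hi, zero_smul]
      exact hardy.zero_mem
    · exact hardy.smul_mem _ (fourierLp_mem_hardy hi)

theorem mem_hardy_orthogonal_iff {u : L2T} : u ∈ hardyᗮ ↔ ∀ n ≥ 0, fourierCoeff u n = 0 := by
  constructor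
  · intro hu n hn
    rw [fourierCoeff_eq_inner]
    exact hu _ (fourierLp_mem_hardy hn)
  · intro h
    have h1 : hardy ≤ (Submodule.span ℂ {u})ᗮ := by
      refine hardy_le_of_isClosed (Submodule.isClosed_orthogonal _) fun m hm => ?_
      rw [Submodule.mem_orthogonal_singleton_iff_inner_left, ← fourierCoeff_eq_inner]
      exact h m hm
    intro v hv
    exact Submodule.mem_orthogonal_singleton_iff_inner_left.1 (h1 hv)

theorem fourierCoeff_hardy (u : hardy) : ∀ n < 0, fourierCoeff (u : L2T) n = 0 :=
  mem_hardy_iff.1 u.2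

theorem memLp_hardy (u : hardy) : MemLp (u : L2T) 2 haar := Lp.memLp _

theorem exists_hardy_of_fourierCoeff {f : UnitAddCircle → ℂ} (hf : MemLp f 2 haar)
    (h : ∀ n < 0, fourierCoeff f n = 0) : ∃ u : hardy, (u : L2T) =ᵐ[haar] f :=
  ⟨⟨hf.toLp f, mem_hardy_iff.2 (by rwa [fourierCoeff_congr_ae hf.coeFn_toLp])⟩, hf.coeFn_toLp⟩

theorem hardy_ext {u v : hardy} (h : (u : L2T) =ᵐ[haar] (v : L2T)) : u = v :=
  Subtype.ext (Lp.ext h)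

theorem hardy_eq_of_fourierCoeff {u v : hardy}
    (h : ∀ n ≥ 0, fourierCoeff (u : L2T) n = fourierCoeff (v : L2T) n) : u = v := by
  refine hardy_ext (ae_eq_of_fourierCoeff_eq (memLp_hardy u) (memLp_hardy v) fun n => ?_)
  rcases lt_or_ge n 0 with hn | hn
  · rw [fourierCoeff_hardy u n hn, fourierCoeff_hardy v n hn]
  · exact h n hn

theorem fourierCoeff_projection (x : L2T) {n : ℤ} (hn : 0 ≤ n) :
    fourierCoeff (hardy.orthogonalProjectionOnto x : L2T) n = fourierCoeff x n := by
  have h := hardy.inner_orthogonalProjectionOnto_eq_of_mem_left ⟨_, fourierLp_mem_hardy hn⟩ x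
  rw [fourierCoeff_eq_inner, fourierCoeff_eq_inner]
  exact h

theorem coeFn_sub_hardy (u v : hardy) :
    ((u - v : hardy) : L2T) =ᵐ[haar] fun t => (u : L2T) t - (v : L2T) t :=
  Lp.coeFn_sub (u : L2T) (v : L2T)

theorem coeFn_smul_hardy (c : ℂ) (u : hardy) :
    ((c • u : hardy) : L2T) =ᵐ[haar] fun t => c * (u : L2T) t :=
  Lp.coeFn_smul c (u : L2T)

theorem fourierCoeff_sub {f g : UnitAddCircle → ℂ} (hf : MemLp f 2 haar) (hg : MemLp g 2 haar)
    (n : ℤ) : fourierCoeff (fun t => f t - g t) n = fourierCoeff f n - fourierCoeff g n := by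
  have h := congr_fun (fourierCoeff.add (hf.integrable one_le_two)
    ((hg.integrable one_le_two).const_mul (-1))) n
  rw [Pi.add_apply, fourierCoeff.const_mul] at h
  rw [sub_eq_add_neg, ← neg_one_mul, ← h]
  congr 1
  funext t
  simp [sub_eq_add_neg]

/-! ### Toeplitz operators: coefficients, symmetry, absence of nonreal eigenvalues. -/

theorem fourierCoeff_toeplitz (ω : UnitAddCircle → ℂ) (u : (toeplitz ω).domain) {n : ℤ}
    (hn : 0 ≤ n) : fourierCoeff (toeplitz ω u : L2T) n
      = fourierCoeff (fun t => ω t * ((u : hardy) : L2T) t) n := by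
  have h := fourierCoeff_projection (mulSymbol ω u) hn
  exact h.trans (congr_fun
    (fourierCoeff_congr_ae (MemLp.coeFn_toLp (mem_toeplitzDomain.1 u.2))) n)

theorem toeplitz_eq_iff (ω : UnitAddCircle → ℂ) (u : (toeplitz ω).domain) (y : hardy) :
    toeplitz ω u = y ↔ ∀ n ≥ 0, fourierCoeff (fun t => ω t * ((u : hardy) : L2T) t) n
      = fourierCoeff (y : L2T) n := by
  constructor
  · rintro rfl n hn
    exact (fourierCoeff_toeplitz ω u hn).symm
  · intro h
    exact hardy_eq_of_fourierCoeff fun n hn => (fourierCoeff_toeplitz ω u hn).trans (h n hn)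

open ComplexConjugate in
theorem inner_toeplitz_left (ω : UnitAddCircle → ℂ) (u : (toeplitz ω).domain) (v : hardy) :
    inner ℂ (toeplitz ω u) v
      = ∫ t, (v : L2T) t * conj (ω t * ((u : hardy) : L2T) t) ∂haar := by
  have h := hardy.inner_orthogonalProjectionOnto_eq_of_mem_right v (mulSymbol ω u)
  refine Eq.trans h ?_
  rw [L2.inner_def]
  refine integral_congr_ae ?_
  filter_upwards [MemLp.coeFn_toLp (mem_toeplitzDomain.1 u.2)] with t ht
  rw [RCLike.inner_apply]
  congr 2

/-- Against elements of `H²` the projection drops out, and the two remaining integrals agree because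
`ω` is real. -/
theorem isFormalAdjoint_toeplitz {ω : UnitAddCircle → ℂ} (hω : ∀ᵐ t ∂haar, (ω t).im = 0) :
    (toeplitz ω).IsFormalAdjoint (toeplitz ω) := by
  intro u v
  rw [← inner_conj_symm (u : hardy), inner_toeplitz_left, inner_toeplitz_left, ← integral_conj]
  refine integral_congr_ae ?_
  filter_upwards [hω] with t ht
  simp only [map_mul, Complex.conj_conj, Complex.conj_eq_iff_im.2 ht]
  ring

theorem toeplitz_eigenvector_eq_zero {ω : UnitAddCircle → ℂ} (hω : ∀ᵐ t ∂haar, (ω t).im = 0)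
    {c : ℂ} (hc : c.im ≠ 0) (u : (toeplitz ω).domain) (hu : toeplitz ω u = c • (u : hardy)) :
    (u : hardy) = 0 := by
  have h := isFormalAdjoint_toeplitz hω u u
  rw [hu] at h
  have h2 := (inner_smul_left (𝕜 := ℂ) (u : hardy) (u : hardy) c).symm.trans
    (h.trans (inner_smul_right (𝕜 := ℂ) (u : hardy) (u : hardy) c))
  by_contra h0
  have h1 := mul_right_cancel₀ (inner_self_ne_zero.2 h0) h2
  exact hc (Complex.conj_eq_iff_im.1 h1)

/-! ### The factors of `S`, the domain, and reduction to bounded symbols. -/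

theorem isRoot_prod_filter_roots {S : ℂ[X]} {r : ℂ → Prop} [DecidablePred r] {z : ℂ}
    (h : ((S.roots.filter r).map fun b => X - C b).prod.IsRoot z) : r z ∧ S.IsRoot z := by
  rw [IsRoot, eval_multiset_prod, Multiset.map_map, Multiset.prod_eq_zero_iff] at h
  obtain ⟨b, hb, hz⟩ := Multiset.mem_map.1 h
  have hz' : z = b := by simpa [sub_eq_zero] using hz
  rw [Multiset.mem_filter] at hb
  exact ⟨hz' ▸ hb.2, hz' ▸ isRoot_of_mem_roots hb.1⟩

theorem isRoot_inPart {S : ℂ[X]} {z : ℂ} (h : (inPart S).IsRoot z) : ‖z‖ < 1 :=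
  (isRoot_prod_filter_roots h).1

theorem isRoot_exPart {S : ℂ[X]} {z : ℂ} (h : (exPart S).IsRoot z) : 1 < ‖z‖ :=
  (isRoot_prod_filter_roots h).1

theorem isRoot_circlePart {S : ℂ[X]} (hS : S ≠ 0) {z : ℂ} (h : (circlePart S).IsRoot z) :
    ‖z‖ = 1 ∧ S.IsRoot z := by
  rw [circlePart, IsRoot, eval_mul, eval_C, mul_eq_zero, leadingCoeff_eq_zero,
    or_iff_right hS] at h
  exact isRoot_prod_filter_roots h

theorem inPart_ne_zero (S : ℂ[X]) : inPart S ≠ 0 :=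
  (monic_multiset_prod_of_monic _ _ fun b _ => monic_X_sub_C b).ne_zero

theorem exPart_ne_zero (S : ℂ[X]) : exPart S ≠ 0 :=
  (monic_multiset_prod_of_monic _ _ fun b _ => monic_X_sub_C b).ne_zero

theorem circlePart_ne_zero {S : ℂ[X]} (hS : S ≠ 0) : circlePart S ≠ 0 := by
  intro h
  have h1 := circlePart_mul_inPart_mul_exPart S
  rw [h, zero_mul, zero_mul] at h1
  exact hS h1.symm

theorem norm_ne_one_of_isRoot_inPart_mul_exPart (S : ℂ[X]) :
    ∀ z, (inPart S * exPart S).IsRoot z → ‖z‖ ≠ 1 := by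
  intro z hz
  rcases root_mul.1 hz with h | h
  · exact (isRoot_inPart h).ne
  · exact (isRoot_exPart h).ne'

theorem eval_parts (S : ℂ[X]) (z : ℂ) :
    (circlePart S).eval z * (inPart S).eval z * (exPart S).eval z = S.eval z := by
  rw [← eval_mul, ← eval_mul, circlePart_mul_inPart_mul_exPart]

theorem memLp_ratFun_mul {A B : ℂ[X]} (hB : ∀ z, B.IsRoot z → ‖z‖ ≠ 1)
    {f : UnitAddCircle → ℂ} (hf : MemLp f 2 haar) :
    MemLp (fun t => ratFun A B t * f t) 2 haar := by
  refine (memLp_div hB (memLp_pmul A hf)).ae_eq (ae_of_all _ fun t => ?_)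
  simp only [pmul, ratFun]
  ring

theorem domain_toeplitz_eq_top {A B : ℂ[X]} (hB : ∀ z, B.IsRoot z → ‖z‖ ≠ 1) :
    (toeplitz (ratFun A B)).domain = ⊤ :=
  Submodule.eq_top_iff'.2 fun u => memLp_ratFun_mul hB (memLp_hardy u)

theorem ratFun_mul_circlePart {R S : ℂ[X]} {t : UnitAddCircle} (ht : S.eval (pt t) ≠ 0) (x : ℂ) :
    ratFun R S t * ((circlePart S).eval (pt t) * x) = ratFun R (inPart S * exPart S) t * x := by
  have h := eval_parts S (pt t)
  rw [← h] at ht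
  simp only [ratFun, eval_mul, ← h]
  have h1 := left_ne_zero_of_mul (left_ne_zero_of_mul ht)
  have h2 := right_ne_zero_of_mul (left_ne_zero_of_mul ht)
  have h3 := right_ne_zero_of_mul ht
  field_simp

theorem mem_domain_iff {R S : ℂ[X]} (hS : S ≠ 0) (hRS : ∀ z : ℂ, ¬ (R.IsRoot z ∧ S.IsRoot z))
    (u : hardy) : u ∈ (toeplitz (ratFun R S)).domain ↔
      ∃ h : hardy, (u : L2T) =ᵐ[haar] pmul (circlePart S) (h : L2T) := by
  constructor
  · intro hu
    have hf : MemLp (fun t => ratFun R S t * (u : L2T) t) 2 haar := hu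
    -- From `a R + b s = 1` the quotient `u / s` equals `a S_in S_ex (ω u) + b u`, which is in `L²`.
    -- It is in `H²` because the zeros of `s` are not in the open disc.
    obtain ⟨a, b, hab⟩ : IsCoprime R (circlePart S) := by
      rw [Polynomial.isCoprime_iff_aeval_ne_zero_of_isAlgClosed ℂ ℂ]
      intro z
      simp only [coe_aeval_eq_eval, ← not_and_or]
      exact fun hz => hRS z ⟨hz.1, (isRoot_circlePart hS hz.2).2⟩
    have hg : MemLp (fun t => pmul (a * inPart S * exPart S)
        (fun t => ratFun R S t * (u : L2T) t) t + pmul b (u : L2T) t) 2 haar :=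
      (memLp_pmul _ hf).add (memLp_pmul b (memLp_hardy u))
    have hsg : pmul (circlePart S) (fun t => pmul (a * inPart S * exPart S)
        (fun t => ratFun R S t * (u : L2T) t) t + pmul b (u : L2T) t) =ᵐ[haar] (u : L2T) := by
      filter_upwards [ae_eval_pt_ne_zero hS] with t ht
      have h1 := eval_parts S (pt t)
      have h2 : a.eval (pt t) * R.eval (pt t) + b.eval (pt t) * (circlePart S).eval (pt t) = 1 := by
        rw [← eval_mul, ← eval_mul, ← eval_add, hab, eval_one]
      have h3 : R.eval (pt t) = ratFun R S t * S.eval (pt t) := (div_mul_cancel₀ _ ht).symm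
      rw [h3, ← h1] at h2
      simp only [pmul, eval_mul]
      linear_combination (u : L2T) t * h2
    obtain ⟨h, hh⟩ := exists_hardy_of_fourierCoeff hg
      (fourierCoeff_eq_zero_of_pmul_low (circlePart_ne_zero hS)
        (fun z hz => (isRoot_circlePart hS hz).1.ge) hg
        (by rw [fourierCoeff_congr_ae hsg]; exact fourierCoeff_hardy u))
    exact ⟨h, hsg.symm.trans (pmul_congr_ae _ hh).symm⟩
  · rintro ⟨h, hh⟩
    refine (memLp_ratFun_mul (A := R) (norm_ne_one_of_isRoot_inPart_mul_exPart S)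
      (memLp_hardy h)).ae_eq ?_
    filter_upwards [hh, ae_eval_pt_ne_zero hS] with t h1 h2
    rw [h1, pmul, ratFun_mul_circlePart h2]

theorem exists_hardy_pmul (P : ℂ[X]) (h : hardy) :
    ∃ u : hardy, (u : L2T) =ᵐ[haar] pmul P (h : L2T) :=
  exists_hardy_of_fourierCoeff (memLp_pmul P (memLp_hardy h))
    (fourierCoeff_pmul_low P (memLp_hardy h) (fourierCoeff_hardy h))

theorem exists_hardy_polynomial (P : ℂ[X]) :
    ∃ u : hardy, (u : L2T) =ᵐ[haar] fun t => P.eval (pt t) :=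
  exists_hardy_of_fourierCoeff (memLp_continuous (continuous_eval_pt P)) fun n hn => by
    rw [fourierCoeff_eval_pt, if_neg hn.not_ge]

/-- For `u = s h` the poles on the circle cancel: `(ω - c) s h = ((R - cS)/(S_in S_ex)) h`. The
symbol on the right is bounded, so `h` ranges over all of `H²`. -/
theorem toeplitz_sub_smul_eq {R S : ℂ[X]} (hS : S ≠ 0) (c : ℂ)
    (u : (toeplitz (ratFun R S)).domain)
    (h : (toeplitz (ratFun (R - C c * S) (inPart S * exPart S))).domain)
    (hu : ((u : hardy) : L2T) =ᵐ[haar] pmul (circlePart S) ((h : hardy) : L2T)) :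
    toeplitz (ratFun R S) u - c • (u : hardy)
      = toeplitz (ratFun (R - C c * S) (inPart S * exPart S)) h := by
  refine hardy_eq_of_fourierCoeff fun n hn => ?_
  have h1 := coeFn_smul_hardy c (u : hardy)
  rw [fourierCoeff_toeplitz _ _ hn, fourierCoeff_congr_ae (coeFn_sub_hardy _ _),
    fourierCoeff_sub (memLp_hardy _) (memLp_hardy _), fourierCoeff_toeplitz _ _ hn,
    ← fourierCoeff_sub (mem_toeplitzDomain.1 u.2) (memLp_hardy _)]
  refine congr_fun (fourierCoeff_congr_ae ?_) n
  filter_upwards [hu, h1, ae_eval_pt_ne_zero hS] with t h2 h3 h4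
  rw [h3, h2, pmul, ratFun_mul_circlePart h4]
  have h5 := eval_parts S (pt t)
  rw [← h5] at h4
  have h6 := right_ne_zero_of_mul (left_ne_zero_of_mul h4)
  have h7 := right_ne_zero_of_mul h4
  simp only [ratFun, eval_sub, eval_mul, eval_C, ← h5]
  field_simp

theorem ranSub_toeplitz {R S : ℂ[X]} (hS : S ≠ 0) (hRS : ∀ z : ℂ, ¬ (R.IsRoot z ∧ S.IsRoot z))
    (c : ℂ) : ranSub (toeplitz (ratFun R S)) c = LinearMap.range
      (toeplitz (ratFun (R - C c * S) (inPart S * exPart S))).toFun := by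
  have hd := domain_toeplitz_eq_top (A := R - C c * S) (norm_ne_one_of_isRoot_inPart_mul_exPart S)
  ext y
  constructor
  · rintro ⟨u, rfl⟩
    obtain ⟨h, hh⟩ := (mem_domain_iff hS hRS u).1 u.2
    have hh' : h ∈ (toeplitz (ratFun (R - C c * S) (inPart S * exPart S))).domain :=
      hd ▸ Submodule.mem_top
    exact ⟨⟨h, hh'⟩, (toeplitz_sub_smul_eq hS c u ⟨h, hh'⟩ hh).symm⟩
  · rintro ⟨h, rfl⟩
    obtain ⟨u, hu⟩ := exists_hardy_pmul (circlePart S) h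
    have hu' := (mem_domain_iff hS hRS u).2 ⟨h, hu⟩
    exact ⟨⟨u, hu'⟩, toeplitz_sub_smul_eq hS c ⟨u, hu'⟩ h hu⟩

/-! ### Density of the domain. -/

open ComplexConjugate in
theorem integral_mul_conj_mul_pow (g v : UnitAddCircle → ℂ) (n : ℕ) :
    ∫ t, v t * conj (g t * pt t ^ n) ∂haar
      = conj (fourierCoeff (fun t => g t * conj (v t)) (-n)) := by
  rw [fourierCoeff, ← integral_conj]
  refine integral_congr_ae (ae_of_all _ fun t => ?_)
  simp only [fourier_eq_zpow, smul_eq_mul, neg_neg, zpow_natCast, map_mul, Complex.conj_conj]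
  ring

open ComplexConjugate in
theorem inner_hardy (u v : hardy) :
    inner ℂ u v = ∫ t, (v : L2T) t * conj ((u : L2T) t) ∂haar := rfl

-- If `v` is orthogonal to all `s z^m`, then `s conj v` has no coefficients at indices `≤ 0`.
-- Division by `s` transfers this to `conj v`, so `v = 0`.
open ComplexConjugate in
theorem dense_domain_toeplitz {R S : ℂ[X]} (hS : S ≠ 0)
    (hRS : ∀ z : ℂ, ¬ (R.IsRoot z ∧ S.IsRoot z)) :
    Dense ((toeplitz (ratFun R S)).domain : Set hardy) := by
  rw [Submodule.dense_iff_topologicalClosure_eq_top, Submodule.topologicalClosure_eq_top_iff,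
    Submodule.eq_bot_iff]
  intro v hv
  have hv' := memLp_conj (memLp_hardy v)
  have h1 : ∀ n < 1, fourierCoeff (pmul (circlePart S) fun t => conj ((v : L2T) t)) n = 0 := by
    intro n hn
    obtain ⟨m, rfl⟩ : ∃ m : ℕ, n = -m := ⟨(-n).toNat, by lia⟩
    obtain ⟨h, hh⟩ := exists_hardy_polynomial (X ^ m)
    obtain ⟨u, hu⟩ := exists_hardy_pmul (circlePart S) h
    have h2 := hv u ((mem_domain_iff hS hRS u).2 ⟨h, hu⟩)
    rw [inner_hardy] at h2
    rw [← map_eq_zero conj]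
    refine (integral_mul_conj_mul_pow (fun t => (circlePart S).eval (pt t)) (v : L2T) m).symm.trans
      (Eq.trans (integral_congr_ae ?_) h2)
    filter_upwards [hh, hu] with t h3 h4
    rw [h4, pmul, h3, eval_pow, eval_X]
  have h2 := fourierCoeff_eq_zero_of_pmul_low (circlePart_ne_zero hS)
    (fun z hz => (isRoot_circlePart hS hz).1.ge) hv' h1
  refine hardy_eq_of_fourierCoeff fun n hn => ?_
  have h3 := h2 (-n) (by lia)
  rw [fourierCoeff_conj, neg_neg, map_eq_zero] at h3
  refine h3.trans (Eq.trans ?_ (congr_fun (fourierCoeff_congr_ae (Lp.coeFn_zero ℂ 2 haar)) n).symm)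
  simp [fourierCoeff]

/-! ### Closedness of the graph. -/

theorem continuous_ratFun (A : ℂ[X]) {B : ℂ[X]} (hB : ∀ z, B.IsRoot z → ‖z‖ ≠ 1) :
    Continuous (ratFun A B) :=
  (continuous_eval_pt A).div (continuous_eval_pt B) fun t ht => hB _ ht (norm_pt t)

/-- The linear map `t ↦ A t / B` from polynomials to `L²`. -/
noncomputable def ratL2 (A : ℂ[X]) {B : ℂ[X]} (hB : ∀ z, B.IsRoot z → ‖z‖ ≠ 1) :
    ℂ[X] →ₗ[ℂ] L2T where
  toFun t := (memLp_continuous (continuous_ratFun (A * t) hB)).toLp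
  map_add' t t' := by
    rw [← MemLp.toLp_add]
    refine MemLp.toLp_congr _ _ (ae_of_all _ fun x => ?_)
    simp only [ratFun, eval_mul, eval_add, Pi.add_apply]
    ring
  map_smul' c t := by
    rw [RingHom.id_apply, ← MemLp.toLp_const_smul]
    refine MemLp.toLp_congr _ _ (ae_of_all _ fun x => ?_)
    simp only [ratFun, eval_mul, eval_smul, Pi.smul_apply, smul_eq_mul]
    ring

theorem coeFn_ratL2 (A : ℂ[X]) {B : ℂ[X]} (hB : ∀ z, B.IsRoot z → ‖z‖ ≠ 1) (t : ℂ[X]) :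
    ratL2 A hB t =ᵐ[haar] ratFun (A * t) B :=
  MemLp.coeFn_toLp (memLp_continuous (continuous_ratFun (A * t) hB))

theorem injective_ratL2 {A B : ℂ[X]} (hA : A ≠ 0) (hB : ∀ z, B.IsRoot z → ‖z‖ ≠ 1) :
    Function.Injective (ratL2 A hB) := by
  rw [injective_iff_map_eq_zero]
  intro t ht
  by_contra h0
  have h1 := coeFn_ratL2 A hB t
  rw [ht] at h1
  have h2 : ∀ᵐ _ : UnitAddCircle ∂haar, False := by
    filter_upwards [h1, Lp.coeFn_zero ℂ 2 haar, ae_eval_pt_ne_zero (mul_ne_zero hA h0)]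
      with x h3 h4 h5
    rw [h4, Pi.zero_apply, ratFun, eq_comm, div_eq_zero_iff] at h3
    exact h3.elim h5 fun h => hB _ h (norm_pt x)
  exact h2.exists.elim fun _ h => h

instance finite_degreeLT (n : ℕ) : Module.Finite ℂ (degreeLT ℂ n) :=
  Module.Finite.equiv (degreeLTEquiv ℂ n).symm

/-- Multiplication by a polynomial as a bounded operator in `L²`. -/
noncomputable def mulL (P : ℂ[X]) : L2T →L[ℂ] L2T :=
  LinearMap.mkContinuousOfExistsBound
    { toFun := fun u => (memLp_pmul P (Lp.memLp u)).toLp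
      map_add' := fun u v => by
        rw [← MemLp.toLp_add]
        refine MemLp.toLp_congr _ _ ?_
        filter_upwards [Lp.coeFn_add u v] with x hx
        simp only [pmul, hx, Pi.add_apply, mul_add]
      map_smul' := fun c u => by
        rw [RingHom.id_apply, ← MemLp.toLp_const_smul]
        refine MemLp.toLp_congr _ _ ?_
        filter_upwards [Lp.coeFn_smul c u] with x hx
        simp only [pmul, hx, Pi.smul_apply, smul_eq_mul, mul_left_comm] }
    (by
      obtain ⟨M, hM⟩ := isCompact_univ.exists_bound_of_continuousOn
        (continuous_eval_pt P).continuousOn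
      refine ⟨M, fun u => Lp.norm_le_mul_norm_of_ae_le_mul ?_⟩
      filter_upwards [(memLp_pmul P (Lp.memLp u)).coeFn_toLp] with x hx
      refine (congr_arg norm hx).trans_le ?_
      rw [pmul, norm_mul]
      exact mul_le_mul_of_nonneg_right (hM x trivial) (norm_nonneg _))

theorem coeFn_mulL (P : ℂ[X]) (u : L2T) : mulL P u =ᵐ[haar] pmul P u :=
  MemLp.coeFn_toLp (memLp_pmul P (Lp.memLp u))

/-- The equation `y = P (ω u)` says that `g = ω u - y` has only negative frequencies, so `S_in g`
has none from `deg S_in` on. Since `s S_ex (S_in g) = R u - S y` is in `H²`, so is `S_in g`, which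
is therefore a polynomial of degree `< deg S_in`. This form makes no reference to the domain. -/
theorem mem_graph_toeplitz_iff {R S : ℂ[X]} (hS : S ≠ 0) (u y : hardy) :
    (u, y) ∈ (toeplitz (ratFun R S)).graph ↔ ∃ t ∈ degreeLT ℂ (inPart S).natDegree,
      (fun x => pmul R (u : L2T) x - pmul S (y : L2T) x)
        =ᵐ[haar] fun x => (circlePart S * exPart S * t).eval (pt x) := by
  have hu' := memLp_hardy u
  have hy' := memLp_hardy y
  rw [LinearPMap.mem_graph_iff]
  constructor
  · rintro ⟨⟨u', hu⟩, rfl, hy⟩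
    rw [toeplitz_eq_iff] at hy
    have hf : MemLp (fun x => ratFun R S x * (u' : L2T) x) 2 haar := hu
    have hg : MemLp (fun x => ratFun R S x * (u' : L2T) x - (y : L2T) x) 2 haar :=
      hf.sub hy'
    have h1 : pmul (circlePart S * exPart S) (pmul (inPart S)
        fun x => ratFun R S x * (u' : L2T) x - (y : L2T) x)
        =ᵐ[haar] fun x => pmul R (u' : L2T) x - pmul S (y : L2T) x := by
      filter_upwards [ae_eval_pt_ne_zero hS] with x hx
      have h2 := eval_parts S (pt x)
      have h3 : R.eval (pt x) = ratFun R S x * S.eval (pt x) := (div_mul_cancel₀ _ hx).symm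
      simp only [pmul, eval_mul, h3, ← h2]
      ring
    obtain ⟨t, ht, hgt⟩ := exists_polynomial_of_fourierCoeff (memLp_pmul (inPart S) hg)
      (inPart S).natDegree
      (fourierCoeff_eq_zero_of_pmul_low
        (mul_ne_zero (circlePart_ne_zero hS) (exPart_ne_zero S))
        (fun z hz => (root_mul.1 hz).elim (fun h => (isRoot_circlePart hS h).1.ge)
          fun h => (isRoot_exPart h).le) (memLp_pmul (inPart S) hg) (by
          intro n hn
          rw [fourierCoeff_congr_ae h1, fourierCoeff_sub (memLp_pmul _ hu') (memLp_pmul _ hy'),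
            fourierCoeff_pmul_low _ hu' (fourierCoeff_hardy u') n hn,
            fourierCoeff_pmul_low _ hy' (fourierCoeff_hardy y) n hn, sub_zero]))
      (by
        have h2 := fourierCoeff_pmul_high (inPart S) hg (N := 0) fun n hn => by
          rw [fourierCoeff_sub hf hy', hy n hn, sub_self]
        rwa [zero_add] at h2)
    refine ⟨t, ht, h1.symm.trans ((pmul_congr_ae _ hgt).trans (ae_of_all _ fun x => ?_))⟩
    simp only [pmul, eval_mul]
  · rintro ⟨t, ht, h⟩
    have hI : ∀ z, (inPart S).IsRoot z → ‖z‖ ≠ 1 := fun z hz => (isRoot_inPart hz).ne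
    have hg : MemLp (ratFun t (inPart S)) 2 haar := memLp_continuous (continuous_ratFun t hI)
    have h1 : (fun x => (y : L2T) x + ratFun t (inPart S) x)
        =ᵐ[haar] fun x => ratFun R S x * (u : L2T) x := by
      filter_upwards [h, ae_eval_pt_ne_zero hS] with x h2 h3
      have h4 := eval_parts S (pt x)
      have h5 : (inPart S).eval (pt x) ≠ 0 := fun h => hI _ h (norm_pt x)
      simp only [ratFun]
      rw [div_mul_eq_mul_div, eq_div_iff h3]
      simp only [pmul, eval_mul] at h2
      have h6 : t.eval (pt x) / (inPart S).eval (pt x) * S.eval (pt x)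
          = (circlePart S).eval (pt x) * (exPart S).eval (pt x) * t.eval (pt x) := by
        rw [← h4]
        field_simp
      linear_combination h6 - h2
    have hu : u ∈ (toeplitz (ratFun R S)).domain := (MemLp.add hy' hg).ae_eq h1
    refine ⟨⟨u, hu⟩, rfl, (toeplitz_eq_iff _ _ _).2 fun n hn => ?_⟩
    -- A quotient `t / S_in` with `deg t < deg S_in` has only negative frequencies, so `P`
    -- annihilates it.
    have h2 : fourierCoeff (ratFun t (inPart S)) n = 0 := by
      refine fourierCoeff_eq_zero_of_pmul_high (inPart_ne_zero S)
        (fun z hz => (isRoot_inPart hz).le) hg (N := (inPart S).natDegree) (fun m hm => ?_) n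
        (by simpa using hn)
      have h3 : pmul (inPart S) (ratFun t (inPart S)) = fun x => t.eval (pt x) := by
        funext x
        exact mul_div_cancel₀ _ fun h => hI _ h (norm_pt x)
      rw [h3, fourierCoeff_eval_pt, if_pos (by lia)]
      exact coeff_eq_zero_of_degree_lt ((mem_degreeLT.1 ht).trans_le (by norm_cast; lia))
    rw [← fourierCoeff_congr_ae h1]
    refine (congr_fun (fourierCoeff.add (hy'.integrable one_le_two)
      (hg.integrable one_le_two)) n).trans ?_
    rw [Pi.add_apply, h2, add_zero]

/-- The graph is the preimage of a finite-dimensional, hence closed, subspace under the bounded map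
`(u, y) ↦ R u - S y`. -/
theorem isClosed_toeplitz {R S : ℂ[X]} (hS : S ≠ 0) : (toeplitz (ratFun R S)).IsClosed := by
  have h1 : ∀ z, (1 : ℂ[X]).IsRoot z → ‖z‖ ≠ 1 := fun z hz => by simp at hz
  let W := (degreeLT ℂ (inPart S).natDegree).map (ratL2 (circlePart S * exPart S) h1)
  have hW : IsClosed (W : Set L2T) := W.closed_of_finiteDimensional
  have hc : Continuous fun x : hardy × hardy => mulL R (x.1 : L2T) - mulL S (x.2 : L2T) := by
    fun_prop
  suffices h : ((toeplitz (ratFun R S)).graph : Set (hardy × hardy))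
      = (fun x : hardy × hardy => mulL R (x.1 : L2T) - mulL S (x.2 : L2T)) ⁻¹' (W : Set L2T) by
    rw [LinearPMap.IsClosed, h]
    exact hW.preimage hc
  ext ⟨u, y⟩
  rw [SetLike.mem_coe, mem_graph_toeplitz_iff hS]
  refine exists_congr fun t => and_congr_right fun _ => ?_
  have h2 : mulL R (u : L2T) - mulL S (y : L2T)
      =ᵐ[haar] fun x => pmul R (u : L2T) x - pmul S (y : L2T) x := by
    filter_upwards [Lp.coeFn_sub (mulL R (u : L2T)) (mulL S (y : L2T)), coeFn_mulL R (u : L2T),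
      coeFn_mulL S (y : L2T)] with x hx hx1 hx2
    rw [hx, Pi.sub_apply, hx1, hx2]
  have h3 : ratL2 (circlePart S * exPart S) h1 t
      =ᵐ[haar] fun x => (circlePart S * exPart S * t).eval (pt x) :=
    (coeFn_ratL2 _ h1 t).trans (ae_of_all _ fun x => by simp [ratFun])
  constructor
  · intro h
    exact Lp.ext (h3.trans (h.symm.trans h2.symm))
  · intro h
    have h4 : ratL2 (circlePart S * exPart S) h1 t = mulL R (u : L2T) - mulL S (y : L2T) := h
    rw [h4] at h3
    exact h2.symm.trans h3

theorem ae_im_ratFun_eq_zero {R S : ℂ[X]} (hS : S ≠ 0)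
    (hreal : ∀ z : ℂ, ‖z‖ = 1 → S.eval z ≠ 0 → (R.eval z / S.eval z).im = 0) :
    ∀ᵐ t ∂haar, (ratFun R S t).im = 0 := by
  filter_upwards [ae_eval_pt_ne_zero hS] with t ht
  exact hreal _ (norm_pt t) ht

/-! ### Reflection of polynomials in the unit circle. -/

section

open ComplexConjugate

theorem breve_C (c : ℂ) : breve (C c) = 1 := by simp [breve]

theorem breve_mul {p q : ℂ[X]} (hp : p ≠ 0) (hq : q ≠ 0) : breve (p * q) = breve p * breve q := by
  simp only [breve, roots_mul (mul_ne_zero hp hq), Multiset.filter_add, Multiset.map_add,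
    Multiset.prod_add]

theorem breve_X : breve X = 1 := by simp [breve, Multiset.filter_singleton]

theorem breve_X_pow (n : ℕ) : breve (X ^ n) = 1 := by
  induction n with
  | zero => simpa using breve_C 1
  | succ n ih => rw [pow_succ, breve_mul (pow_ne_zero n X_ne_zero) X_ne_zero, ih, breve_X, one_mul]

theorem breve_X_sub_C {b : ℂ} (hb : b ≠ 0) : breve (X - C b) = X - C (conj b)⁻¹ := by
  simp [breve, Multiset.filter_singleton, hb]

theorem monic_breve (p : ℂ[X]) : (breve p).Monic :=
  monic_multiset_prod_of_monic _ _ fun _ _ => monic_X_sub_C _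

theorem isRoot_breve {p : ℂ[X]} {z : ℂ} (h : (breve p).IsRoot z) :
    ∃ b, p.IsRoot b ∧ b ≠ 0 ∧ z = (conj b)⁻¹ := by
  rw [breve, IsRoot, eval_multiset_prod, Multiset.map_map, Multiset.prod_eq_zero_iff] at h
  obtain ⟨b, hb, hz⟩ := Multiset.mem_map.1 h
  rw [Multiset.mem_filter] at hb
  exact ⟨b, isRoot_of_mem_roots hb.1, hb.2, by simpa [sub_eq_zero] using hz⟩

theorem eval_zero_breve_ne_zero (p : ℂ[X]) : (breve p).eval 0 ≠ 0 := by
  intro h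
  obtain ⟨b, -, hb, h0⟩ := isRoot_breve h
  exact inv_ne_zero ((_root_.map_ne_zero conj).2 hb) h0.symm

theorem one_lt_norm_of_isRoot_breve {p : ℂ[X]} (hp : ∀ z, p.IsRoot z → ‖z‖ < 1) :
    ∀ z, (breve p).IsRoot z → 1 < ‖z‖ := by
  intro z hz
  obtain ⟨b, hb, hb0, rfl⟩ := isRoot_breve hz
  rw [norm_inv, RCLike.norm_conj]
  exact (one_lt_inv₀ (norm_pos_iff.2 hb0)).2 (hp b hb)

theorem norm_lt_one_of_isRoot_breve {p : ℂ[X]} (hp : ∀ z, p.IsRoot z → 1 < ‖z‖) :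
    ∀ z, (breve p).IsRoot z → ‖z‖ < 1 := by
  intro z hz
  obtain ⟨b, hb, hb0, rfl⟩ := isRoot_breve hz
  rw [norm_inv, RCLike.norm_conj]
  exact inv_lt_one_of_one_lt₀ (hp b hb)

/-- On the unit circle a polynomial and its reflection are conjugate up to a monomial factor. -/
theorem exists_conj_eval_eq {p : ℂ[X]} (hp : p ≠ 0) : ∃ c : ℂ, c ≠ 0 ∧ ∀ z : ℂ, ‖z‖ = 1 →
    conj (p.eval z) * z ^ p.natDegree = c * (breve p).eval z := by
  induction p, hp using induction_on_linear_factors with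
  | hC c hc => exact ⟨conj c, by simpa using hc, fun z _ => by simp [breve_C]⟩
  | hmul b q hq ih =>
    obtain ⟨c, hc, h⟩ := ih
    have hz (z : ℂ) (hz : ‖z‖ = 1) : conj z * z = 1 := by
      rw [Complex.conj_mul', hz]
      norm_num
    simp only [natDegree_mul (X_sub_C_ne_zero b) hq, natDegree_X_sub_C,
      breve_mul (X_sub_C_ne_zero b) hq, eval_mul, eval_sub, eval_X, eval_C, map_mul, map_sub]
    rcases eq_or_ne b 0 with rfl | hb
    · refine ⟨c, hc, fun z h1 => ?_⟩
      have hX : breve (X - C (0 : ℂ)) = 1 := by rw [C_0, sub_zero, breve_X]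
      rw [hX, eval_one, pow_add, pow_one, map_zero]
      linear_combination h z h1 + conj (q.eval z) * z ^ q.natDegree * hz z h1
    · have hb' : conj b ≠ 0 := by simpa using hb
      refine ⟨-conj b * c, mul_ne_zero (neg_ne_zero.2 hb') hc, fun z h1 => ?_⟩
      rw [breve_X_sub_C hb, pow_add, pow_one, eval_sub, eval_X, eval_C]
      linear_combination (1 - conj b * z) * h z h1
        + conj (q.eval z) * z ^ q.natDegree * hz z h1 - c * (breve q).eval z *
          mul_inv_cancel₀ hb'

theorem roots_breve (S : ℂ[X]) :
    (breve S).roots = (S.roots.filter (· ≠ 0)).map fun b => (conj b)⁻¹ := by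
  have h : breve S =
      (((S.roots.filter (· ≠ 0)).map fun b => (conj b)⁻¹).map fun b => X - C b).prod := by
    rw [Multiset.map_map]
    rfl
  rw [h, roots_multiset_prod_X_sub_C]

/-- Inversion in the circle exchanges the nonzero zeros inside the disc with zeros outside. The
numerator thus becomes a reflection of `S_in`, the form in which it arises from conjugation. -/
theorem exPart_breve (S : ℂ[X]) : exPart (breve S) = breve (inPart S) := by
  rw [exPart, roots_breve, breve, inPart, roots_multiset_prod_X_sub_C, Multiset.filter_map,
    Multiset.map_map, Multiset.filter_filter, Multiset.filter_filter]
  refine congr_arg (fun s => (Multiset.map _ s).prod) (Multiset.filter_congr fun b _ => ?_)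
  rw [Function.comp_apply, norm_inv, RCLike.norm_conj, and_comm]
  exact and_congr_right fun hb => one_lt_inv₀ (norm_pos_iff.2 hb)

/-- The condition `q(0) ≠ 0` is needed because reflection discards zeros at the origin; the constant
is needed because reflections are monic. -/
theorem breve_breve {q : ℂ[X]} (hq : q ≠ 0) (h0 : q.eval 0 ≠ 0) :
    ∃ c : ℂ, c ≠ 0 ∧ q = C c * breve (breve q) := by
  induction q, hq using induction_on_linear_factors with
  | hC c hc => exact ⟨c, hc, by rw [breve_C, ← C_1, breve_C, mul_one]⟩
  | hmul b q hq ih =>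
    rw [eval_mul] at h0
    obtain ⟨c, hc, h⟩ := ih (right_ne_zero_of_mul h0)
    have hb : b ≠ 0 := by simpa using left_ne_zero_of_mul h0
    refine ⟨c, hc, ?_⟩
    rw [breve_mul (X_sub_C_ne_zero b) hq, breve_mul (monic_breve _).ne_zero (monic_breve _).ne_zero,
      breve_X_sub_C hb, breve_X_sub_C (by simpa using hb)]
    conv_lhs => rw [h]
    simp
    ring

theorem natDegree_breve {q : ℂ[X]} (hq : q ≠ 0) (h0 : q.eval 0 ≠ 0) :
    (breve q).natDegree = q.natDegree := by
  induction q, hq using induction_on_linear_factors with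
  | hC c hc => rw [breve_C, natDegree_one, natDegree_C]
  | hmul b q hq ih =>
    rw [eval_mul] at h0
    have hb : b ≠ 0 := by simpa using left_ne_zero_of_mul h0
    rw [breve_mul (X_sub_C_ne_zero b) hq, natDegree_mul (X_sub_C_ne_zero b) hq,
      natDegree_mul (monic_breve _).ne_zero (monic_breve _).ne_zero,
      breve_X_sub_C hb, ih (right_ne_zero_of_mul h0), natDegree_X_sub_C, natDegree_X_sub_C]

theorem exists_conj_eval_of_degreeLT {k : ℕ} {t : ℂ[X]} (ht : t ∈ degreeLT ℂ (k + 1)) :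
    ∃ t' ∈ degreeLT ℂ (k + 1), ∀ z : ℂ, ‖z‖ = 1 → t'.eval z = z ^ k * conj (t.eval z) := by
  have h1 : (t.map (starRingEnd ℂ)).natDegree ≤ k := by
    rw [natDegree_map]
    exact natDegree_le_iff_degree_le.2 (Order.le_of_lt_succ (mem_degreeLT.1 ht))
  refine ⟨reflect k (t.map (starRingEnd ℂ)), mem_degreeLT.2 ?_, fun z hz => ?_⟩
  · refine degree_le_natDegree.trans_lt ?_
    have := natDegree_reflect_le (N := k) (p := t.map (starRingEnd ℂ))
    exact_mod_cast Nat.lt_succ_of_le (this.trans (max_le le_rfl h1))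
  · have hz0 : z ≠ 0 := fun h => by simp [h] at hz
    have hzi : conj z = z⁻¹ := (Complex.inv_eq_conj hz).symm
    -- The reversal identity is applied at `conj z`, whose inverse is `z` on the circle.
    let _ : Invertible (conj z) := invertibleOfNonzero (by simpa using hz0)
    have h2 := eval₂_reflect_mul_pow (RingHom.id ℂ) (conj z) k (t.map (starRingEnd ℂ)) h1
    rw [invOf_eq_inv, hzi, inv_inv, ← hzi, eval₂_id, eval₂_id, eval_map, eval₂_at_apply,
      hzi] at h2
    rw [← h2, mul_left_comm, ← mul_pow, mul_inv_cancel₀ hz0, one_pow, mul_one]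

/-! ### The orthogonal complement of the range of a bounded Toeplitz operator. -/

/-- Testing against the image of `z^m` gives the coefficient at `-m` of `(A/B) conj v`. Conversely,
if these all vanish, the conjugate function is orthogonal to `H²`. -/
theorem mem_orthogonal_range_toeplitz_iff {A B : ℂ[X]} (hB : ∀ z, B.IsRoot z → ‖z‖ ≠ 1)
    (v : hardy) : v ∈ (LinearMap.range (toeplitz (ratFun A B)).toFun)ᗮ ↔
      ∀ n < 1, fourierCoeff (fun t => ratFun A B t * conj ((v : L2T) t)) n = 0 := by
  have hd := domain_toeplitz_eq_top (A := A) hB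
  constructor
  · intro hv n hn
    obtain ⟨m, rfl⟩ : ∃ m : ℕ, n = -m := ⟨(-n).toNat, by lia⟩
    obtain ⟨h, hh⟩ := exists_hardy_polynomial (X ^ m)
    have hh' : h ∈ (toeplitz (ratFun A B)).domain := hd ▸ Submodule.mem_top
    have h2 := (inner_toeplitz_left (ratFun A B) ⟨h, hh'⟩ v).symm.trans (hv _ ⟨⟨h, hh'⟩, rfl⟩)
    rw [← _root_.map_eq_zero conj, ← integral_mul_conj_mul_pow]
    refine Eq.trans (integral_congr_ae ?_) h2
    filter_upwards [hh] with t h3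
    rw [h3, eval_pow, eval_X]
  · rintro hv _ ⟨h, rfl⟩
    refine (inner_toeplitz_left (ratFun A B) h v).trans ?_
    have hg := memLp_conj (memLp_ratFun_mul (A := A) hB (memLp_conj (memLp_hardy v)))
    have hg' : hg.toLp ∈ hardyᗮ := by
      rw [mem_hardy_orthogonal_iff, fourierCoeff_congr_ae hg.coeFn_toLp]
      intro n hn
      rw [fourierCoeff_conj, hv (-n) (by lia), map_zero]
    refine Eq.trans (integral_congr_ae ?_) (hg' _ (h : hardy).2)
    filter_upwards [hg.coeFn_toLp] with t ht
    rw [RCLike.inner_apply, ht]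
    simp only [map_mul, Complex.conj_conj]
    ring

section Kernel

variable {p q I E : ℂ[X]}

/-- The orthogonal complement of the range of the Toeplitz operator with symbol `p q / (I E)`, where
`p`, `I` have their zeros inside the disc and `q`, `E` outside of it. -/
theorem mem_orthogonal_range_toeplitz_iff_exists (hp0 : p ≠ 0) (hq0 : q ≠ 0) (hI0 : I ≠ 0)
    (hE0 : E ≠ 0) (hp : ∀ z, p.IsRoot z → ‖z‖ < 1) (hq : ∀ z, q.IsRoot z → 1 < ‖z‖)
    (hI : ∀ z, I.IsRoot z → ‖z‖ < 1) (hE : ∀ z, E.IsRoot z → 1 < ‖z‖) (v : hardy) :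
    v ∈ (LinearMap.range (toeplitz (ratFun (p * q) (I * E))).toFun)ᗮ ↔
      ∃ t ∈ degreeLT ℂ (p.natDegree - I.natDegree),
        (v : L2T) =ᵐ[haar] ratFun (breve I * t) (breve p) := by
  have hIE : ∀ z, (I * E).IsRoot z → ‖z‖ ≠ 1 := fun z hz =>
    (root_mul.1 hz).elim (fun h => (hI z h).ne) fun h => (hE z h).ne'
  have hI1 : ∀ z, I.IsRoot z → ‖z‖ ≠ 1 := fun z hz => (hI z hz).ne
  have hbp := one_lt_norm_of_isRoot_breve hp
  have hpt (x : UnitAddCircle) : p.eval (pt x) ≠ 0 := fun h => (hp _ h).ne (norm_pt x)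
  have hIt (x : UnitAddCircle) : I.eval (pt x) ≠ 0 := fun h => (hI _ h).ne (norm_pt x)
  have hEt (x : UnitAddCircle) : E.eval (pt x) ≠ 0 := fun h => (hE _ h).ne' (norm_pt x)
  have hbpt (x : UnitAddCircle) : (breve p).eval (pt x) ≠ 0 :=
    fun h => (hbp _ h).ne' (norm_pt x)
  have hw := memLp_conj (memLp_hardy v)
  obtain ⟨a, ha, hpa⟩ := exists_conj_eval_eq hp0
  obtain ⟨b, hb, hIb⟩ := exists_conj_eval_eq hI0
  rw [mem_orthogonal_range_toeplitz_iff hIE]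
  have hf := memLp_ratFun_mul (A := p * q) hIE hw
  constructor
  · intro h
    have hg := memLp_ratFun_mul (A := p) hI1 hw
    set g := fun x => ratFun p I x * conj ((v : L2T) x) with hgdef
    -- The factor `q/E` is removed by multiplying by `E` and dividing by `q`; both preserve
    -- vanishing at indices `≤ 0`.
    have h1 : ∀ n < 1, fourierCoeff g n = 0 := by
      refine fourierCoeff_eq_zero_of_pmul_low hq0 (fun z hz => (hq z hz).le) hg ?_
      have h2 := fourierCoeff_pmul_low E hf h
      have h3 : pmul q g = pmul E fun x => ratFun (p * q) (I * E) x * conj ((v : L2T) x) := by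
        funext x
        have := hIt x
        have := hEt x
        simp only [pmul, hgdef, ratFun, eval_mul]
        field_simp
      rwa [h3]
    -- The function `conj v` has no positive frequencies; multiplication by `p` raises the bound by
    -- `deg p`, division by `I` lowers it by `deg I`.
    have h2 : ∀ n ≥ 1 + (p.natDegree : ℤ) - I.natDegree, fourierCoeff g n = 0 := by
      refine fourierCoeff_eq_zero_of_pmul_high hI0 (fun z hz => (hI z hz).le) hg ?_
      have h3 := fourierCoeff_pmul_high p hw (N := 1) fun n hn => by
        rw [fourierCoeff_conj, fourierCoeff_hardy v _ (by lia), map_zero]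
      have h4 : pmul I g = pmul p fun x => conj ((v : L2T) x) := by
        funext x
        have := hIt x
        simp only [pmul, hgdef, ratFun]
        field_simp
      rwa [h4]
    -- The spectrum of `g` lies in `1, …, deg p - deg I`, so `g / z` is a polynomial with `deg p -
    -- deg I` free coefficients.
    have hg1 : MemLp (fun x => (pt x)⁻¹ * g x) 2 haar :=
      memLp_continuous_mul hg (continuous_pt.inv₀ pt_ne_zero)
    have h3 (n : ℤ) : fourierCoeff (fun x => (pt x)⁻¹ * g x) n = fourierCoeff g (n + 1) := by
      have h4 := fourierCoeff_pt_pow_mul (fun x => (pt x)⁻¹ * g x) 1 (n + 1)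
      rw [Nat.cast_one, add_sub_cancel_right] at h4
      rw [← h4]
      congr 1
      funext x
      rw [pow_one, mul_inv_cancel_left₀ (pt_ne_zero x)]
    obtain ⟨t₁, ht₁, h4⟩ := exists_polynomial_of_fourierCoeff hg1 (p.natDegree - I.natDegree)
      (fun n hn => by rw [h3, h1 _ (by lia)])
      (fun n hn => by
        rw [h3]
        rcases lt_or_ge (n + 1) 1 with h5 | h5
        · exact h1 _ h5
        · exact h2 _ (by lia))
    -- The subtraction is truncated: if it gives `0`, then `v = 0`; otherwise polynomials of degree
    -- at most `k` can be reversed.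
    rcases hk : p.natDegree - I.natDegree with _ | k
    · refine ⟨0, Submodule.zero_mem _, ?_⟩
      have ht0 : t₁ = 0 := by
        rw [hk, mem_degreeLT] at ht₁
        simpa using ht₁
      filter_upwards [h4] with x h5
      rw [ht0, eval_zero, hgdef] at h5
      simp only [ratFun, mul_eq_zero, inv_eq_zero, pt_ne_zero, false_or, div_eq_zero_iff, hpt, hIt,
        _root_.map_eq_zero] at h5
      rw [h5, mul_zero, ratFun, eval_zero, zero_div]
    · rw [hk] at ht₁
      obtain ⟨t₂, ht₂, h5⟩ := exists_conj_eval_of_degreeLT ht₁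
      -- Conjugating `p conj v = I z t₁` and inserting `conj p z^(deg p) = a p˘` and `conj I z^(deg
      -- I) = b I˘` gives `a p˘ v = b I˘ z^k conj t₁`.
      refine ⟨C (b / a) * t₂, ?_, ?_⟩
      · rw [← smul_eq_C_mul]
        exact Submodule.smul_mem _ _ ht₂
      · filter_upwards [h4] with x h6
        have h7 := hpa _ (norm_pt x)
        have h8 := hIb _ (norm_pt x)
        have h9 : p.eval (pt x) * conj ((v : L2T) x) = I.eval (pt x) * pt x * t₁.eval (pt x) := by
          rw [← h6, hgdef]
          simp only [ratFun]
          field_simp [hIt x, pt_ne_zero x]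
        have h10 := congr_arg conj h9
        simp only [map_mul, Complex.conj_conj, conj_pt] at h10
        simp only [ratFun, eval_mul, eval_C, h5 _ (norm_pt x)]
        rw [eq_div_iff (hbpt x)]
        have hz := pt_ne_zero x
        have hdeg : pt x ^ p.natDegree = pt x ^ I.natDegree * pt x ^ k * pt x := by
          rw [← pow_add, ← pow_succ]
          congr 1
          lia
        refine mul_left_cancel₀ ha ?_
        have h11 : pt x ^ p.natDegree * (conj (p.eval (pt x)) * (v : L2T) x)
            = pt x ^ p.natDegree * (conj (I.eval (pt x)) * (pt x)⁻¹ * conj (t₁.eval (pt x))) := by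
          rw [h10]
        have h12 : a * ((v : L2T) x * (breve p).eval (pt x))
            = b * (breve I).eval (pt x) * pt x ^ k * conj (t₁.eval (pt x)) := by
          rw [← h8]
          calc _ = (v : L2T) x * (a * (breve p).eval (pt x)) := by ring
            _ = pt x ^ p.natDegree * (conj (p.eval (pt x)) * (v : L2T) x) := by
              rw [← h7]; ring
            _ = _ := by
              rw [h11, hdeg]
              field_simp
        rw [h12]
        field_simp
  · rintro ⟨t, ht, h⟩
    rcases hk : p.natDegree - I.natDegree with _ | k
    · have ht0 : t = 0 := by
        rw [hk, mem_degreeLT] at ht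
        simpa using ht
      have h1 : (fun x => ratFun (p * q) (I * E) x * conj ((v : L2T) x)) =ᵐ[haar]
          fun x => (0 : ℂ[X]).eval (pt x) := by
        filter_upwards [h] with x hx
        simp [hx, ht0, ratFun]
      intro n _
      rw [fourierCoeff_congr_ae h1, fourierCoeff_eval_pt]
      simp
    · rw [hk] at ht
      obtain ⟨t₁, -, h1⟩ := exists_conj_eval_of_degreeLT ht
      refine fourierCoeff_eq_zero_of_pmul_low hE0 (fun z hz => (hE z hz).le) hf ?_
      -- Up to a constant, `E` times the function is the polynomial `q t₁ z`. Its factor `z` removes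
      -- the coefficient at `0`, and division by `E` preserves the vanishing.
      have h2 : pmul E (fun x => ratFun (p * q) (I * E) x * conj ((v : L2T) x)) =ᵐ[haar]
          fun x => (C (conj a / conj b) * q * t₁ * X).eval (pt x) := by
        filter_upwards [h] with x hx
        have h7 := congr_arg conj (hpa _ (norm_pt x))
        have h8 := congr_arg conj (hIb _ (norm_pt x))
        have hz := pt_ne_zero x
        simp only [map_mul, map_pow, Complex.conj_conj, conj_pt] at h7 h8
        have hdeg : pt x ^ p.natDegree = pt x ^ I.natDegree * pt x ^ k * pt x := by
          rw [← pow_add, ← pow_succ]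
          congr 1
          lia
        have ha' : conj a ≠ 0 := (_root_.map_ne_zero conj).2 ha
        have hb' : conj b ≠ 0 := (_root_.map_ne_zero conj).2 hb
        have hbI : conj ((breve I).eval (pt x))
            = I.eval (pt x) * (pt x)⁻¹ ^ I.natDegree / conj b := by
          rw [h8, mul_div_cancel_left₀ _ hb']
        have hbP : conj ((breve p).eval (pt x))
            = p.eval (pt x) * (pt x)⁻¹ ^ p.natDegree / conj a := by
          rw [h7, mul_div_cancel_left₀ _ ha']
        simp only [pmul, hx, ratFun, eval_mul, map_div₀, map_mul, eval_C, eval_X, hbI, hbP,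
          h1 _ (norm_pt x), inv_pow, hdeg]
        have := hpt x
        have := hIt x
        have := hEt x
        field_simp
      intro n hn
      rw [fourierCoeff_congr_ae h2, fourierCoeff_eval_pt]
      split_ifs with h0
      · obtain rfl : n = 0 := by lia
        simp
      · rfl

theorem exists_hardy_ratFun {A B : ℂ[X]} (hB0 : B ≠ 0) (hB : ∀ z, B.IsRoot z → 1 < ‖z‖) :
    ∃ u : hardy, (u : L2T) =ᵐ[haar] ratFun A B := by
  have hf := memLp_continuous (continuous_ratFun A fun z hz => (hB z hz).ne')
  refine exists_hardy_of_fourierCoeff hf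
    (fourierCoeff_eq_zero_of_pmul_low hB0 (fun z hz => (hB z hz).le) hf ?_)
  have h : pmul B (ratFun A B) = fun x => A.eval (pt x) := by
    funext x
    exact mul_div_cancel₀ _ fun h => (hB _ h).ne' (norm_pt x)
  intro n hn
  rw [h, fourierCoeff_eval_pt, if_neg hn.not_ge]

end Kernel

theorem mem_degreeLT_iff_natDegree {t : ℂ[X]} {k : ℕ} {n : ℤ} (hn : n = k) :
    t ∈ degreeLT ℂ k ↔ t = 0 ∨ (t.natDegree : ℤ) < n := by
  rw [mem_degreeLT]
  rcases eq_or_ne t 0 with rfl | ht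
  · simp
  · rw [degree_eq_natDegree ht, hn]
    simp [ht]

/-- The dimension and the elements of the orthogonal complement of the range of the Toeplitz
operator with symbol `p q / (S_in S_ex)`. -/
theorem orthogonal_range_toeplitz {p q S : ℂ[X]} (hp0 : p ≠ 0) (hq0 : q ≠ 0)
    (hp : ∀ z, p.IsRoot z → ‖z‖ < 1) (hq : ∀ z, q.IsRoot z → 1 < ‖z‖)
    (hle : (inPart S).natDegree ≤ p.natDegree) {K : Submodule ℂ hardy}
    (hK : K = (LinearMap.range (toeplitz (ratFun (p * q) (inPart S * exPart S))).toFun)ᗮ) :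
    (FiniteDimensional ℂ K ∧
      (Module.finrank ℂ K : ℤ) = (p.natDegree : ℤ) - ((inPart S).natDegree : ℤ)) ∧
    ConsistsOf K (polyMultiples (exPart (breve S)) (breve p)
      ((p.natDegree : ℤ) - ((inPart S).natDegree : ℤ))) := by
  have hk : (p.natDegree : ℤ) - ((inPart S).natDegree : ℤ)
      = (p.natDegree - (inPart S).natDegree : ℕ) := by lia
  have hmem (v : hardy) := mem_orthogonal_range_toeplitz_iff_exists hp0 hq0 (inPart_ne_zero S)
    (exPart_ne_zero S) hp hq (fun _ => isRoot_inPart) (fun _ => isRoot_exPart) v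
  rw [← hK] at hmem
  rw [exPart_breve]
  have hbp := one_lt_norm_of_isRoot_breve hp
  have hbp' : ∀ z, (breve p).IsRoot z → ‖z‖ ≠ 1 := fun z hz => (hbp z hz).ne'
  have hex (t : ℂ[X]) := exists_hardy_ratFun (A := breve (inPart S) * t) (monic_breve p).ne_zero hbp
  have hmap : K.map hardy.subtype = (degreeLT ℂ (p.natDegree - (inPart S).natDegree)).map
      (ratL2 (breve (inPart S)) hbp') := by
    ext w
    constructor
    · rintro ⟨v, hv, rfl⟩
      obtain ⟨t, ht, h⟩ := (hmem v).1 hv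
      exact ⟨t, ht, Lp.ext ((coeFn_ratL2 _ hbp' t).trans h.symm)⟩
    · rintro ⟨t, ht, rfl⟩
      obtain ⟨v, hv⟩ := hex t
      exact ⟨v, (hmem v).2 ⟨t, ht, hv⟩, Lp.ext (hv.trans (coeFn_ratL2 _ hbp' t).symm)⟩
  have e : K ≃ₗ[ℂ] degreeLT ℂ (p.natDegree - (inPart S).natDegree) :=
    (K.equivMapOfInjective hardy.subtype hardy.injective_subtype).trans
      ((LinearEquiv.ofEq _ _ hmap).trans ((degreeLT ℂ _).equivMapOfInjective _
        (injective_ratL2 (monic_breve (inPart S)).ne_zero hbp')).symm)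
  refine ⟨⟨Module.Finite.equiv e.symm, ?_⟩, ?_, ?_⟩
  · rw [hk, e.finrank_eq, (degreeLTEquiv ℂ _).finrank_eq, Module.finrank_fin_fun]
  · intro v hv
    obtain ⟨t, ht, h⟩ := (hmem v).1 hv
    exact ⟨_, ⟨t, (mem_degreeLT_iff_natDegree hk).1 ht, rfl⟩, h⟩
  · rintro _ ⟨t, ht, rfl⟩
    obtain ⟨v, hv⟩ := hex t
    exact ⟨v, (hmem v).2 ⟨t, (mem_degreeLT_iff_natDegree hk).2 ht, hv⟩, hv⟩

/-! ### The degree bound and the relation between `R - iS` and `R + iS`. -/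

/-- The injectivity of `T - c` for nonreal `c` bounds the number of poles inside the disc. -/
theorem natDegree_inPart_le {R S p q : ℂ[X]} (hS : S ≠ 0)
    (hRS : ∀ z : ℂ, ¬ (R.IsRoot z ∧ S.IsRoot z))
    (hreal : ∀ z : ℂ, ‖z‖ = 1 → S.eval z ≠ 0 → (R.eval z / S.eval z).im = 0) {c : ℂ}
    (hc : c.im ≠ 0) (hpq : R - C c * S = p * q) (hq0 : q ≠ 0) (hq : ∀ z, q.IsRoot z → 1 < ‖z‖) :
    (inPart S).natDegree ≤ p.natDegree := by
  by_contra! hlt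
  have hI : ∀ z, (inPart S).IsRoot z → ‖z‖ ≠ 1 := fun z hz => (isRoot_inPart hz).ne
  -- For `h = S_ex / q` the reduced operator gives `P (p / S_in)`. If `deg p < deg S_in`, this is
  -- zero, and `s h` would be an eigenvector with the nonreal eigenvalue `c`.
  obtain ⟨h, hh⟩ := exists_hardy_ratFun (A := exPart S) hq0 hq
  obtain ⟨u, hu⟩ := exists_hardy_pmul (circlePart S) h
  have hud := (mem_domain_iff hS hRS u).2 ⟨h, hu⟩
  have hhd : h ∈ (toeplitz (ratFun (R - C c * S) (inPart S * exPart S))).domain :=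
    domain_toeplitz_eq_top (norm_ne_one_of_isRoot_inPart_mul_exPart S) ▸ Submodule.mem_top
  have h1 := toeplitz_sub_smul_eq hS c ⟨u, hud⟩ ⟨h, hhd⟩ hu
  have h2 : toeplitz (ratFun (R - C c * S) (inPart S * exPart S)) ⟨h, hhd⟩ = 0 := by
    rw [toeplitz_eq_iff]
    intro n hn
    have h3 : (fun t => ratFun (R - C c * S) (inPart S * exPart S) t * (h : L2T) t)
        =ᵐ[haar] ratFun p (inPart S) := by
      filter_upwards [hh] with t ht
      have h4 : q.eval (pt t) ≠ 0 := fun h => (hq _ h).ne' (norm_pt t)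
      have h5 : (inPart S).eval (pt t) ≠ 0 := fun h => hI _ h (norm_pt t)
      have h6 : (exPart S).eval (pt t) ≠ 0 := fun h => (isRoot_exPart h).ne' (norm_pt t)
      rw [ht, hpq]
      simp only [ratFun, eval_mul]
      field_simp
    have h4 : fourierCoeff (ratFun p (inPart S)) n = 0 := by
      refine fourierCoeff_eq_zero_of_pmul_high (inPart_ne_zero S)
        (fun z hz => (isRoot_inPart hz).le) (memLp_continuous (continuous_ratFun p hI))
        (N := (inPart S).natDegree) (fun m hm => ?_) n (by simpa using hn)
      have h5 : pmul (inPart S) (ratFun p (inPart S)) = fun x => p.eval (pt x) := by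
        funext x
        exact mul_div_cancel₀ _ fun h => hI _ h (norm_pt x)
      rw [h5, fourierCoeff_eval_pt, if_pos (by lia)]
      exact coeff_eq_zero_of_natDegree_lt (by lia)
    refine ((congr_fun (fourierCoeff_congr_ae h3) n).trans h4).trans (Eq.trans ?_
      (congr_fun (fourierCoeff_congr_ae (Lp.coeFn_zero ℂ 2 haar)) n).symm)
    simp [fourierCoeff]
  have h3 : u = 0 := toeplitz_eigenvector_eq_zero (ae_im_ratFun_eq_zero hS hreal) hc ⟨u, hud⟩
    (sub_eq_zero.1 (h1.trans h2))
  have h4 : ∀ᵐ _ : UnitAddCircle ∂haar, False := by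
    filter_upwards [hh, hu, Lp.coeFn_zero ℂ 2 haar, ae_eval_pt_ne_zero (circlePart_ne_zero hS)]
      with t h5 h6 h7 h8
    have h9 : (u : L2T) t = 0 := by
      rw [h3]
      exact h7
    rw [h6, pmul, h5, ratFun] at h9
    exact mul_ne_zero h8 (div_ne_zero (fun h => (isRoot_exPart h).ne' (norm_pt t))
      fun h => (hq _ h).ne' (norm_pt t)) h9
  exact h4.exists.elim fun _ h => h

/-- At a zero of `S` on the circle coprimality would fail; elsewhere the real number `ω(z)` would
equal `i`. -/
theorem eval_sub_I_mul_ne_zero {R S : ℂ[X]} (hRS : ∀ z : ℂ, ¬ (R.IsRoot z ∧ S.IsRoot z))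
    (hreal : ∀ z : ℂ, ‖z‖ = 1 → S.eval z ≠ 0 → (R.eval z / S.eval z).im = 0) {z : ℂ}
    (hz : ‖z‖ = 1) : (R - C Complex.I * S).eval z ≠ 0 := by
  intro h
  rw [eval_sub, eval_mul, eval_C, sub_eq_zero] at h
  by_cases h0 : S.eval z = 0
  · exact hRS z ⟨by rw [IsRoot, h, h0, mul_zero], h0⟩
  · have h1 := hreal z hz h0
    rw [h, mul_div_cancel_right₀ _ h0] at h1
    simp at h1

theorem exists_isFactorization {R S : ℂ[X]} (hRS : ∀ z : ℂ, ¬ (R.IsRoot z ∧ S.IsRoot z))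
    (hreal : ∀ z : ℂ, ‖z‖ = 1 → S.eval z ≠ 0 → (R.eval z / S.eval z).im = 0) :
    ∃ p q : ℂ[X], IsFactorization R S p q := by
  have hF (z : ℂ) (hz : ‖z‖ = 1) := eval_sub_I_mul_ne_zero hRS hreal hz
  have hF0 : R - C Complex.I * S ≠ 0 := fun h => hF 1 norm_one (by rw [h, eval_zero])
  refine ⟨inPart (R - C Complex.I * S),
    circlePart (R - C Complex.I * S) * exPart (R - C Complex.I * S), ?_,
    fun z hz => isRoot_inPart hz, fun z hz => ?_⟩
  · rw [← mul_assoc, mul_comm (inPart _), circlePart_mul_inPart_mul_exPart]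
  · rcases root_mul.1 hz with h | h
    · exact absurd (isRoot_circlePart hF0 h).2 (hF z (isRoot_circlePart hF0 h).1)
    · exact isRoot_exPart h

theorem eq_of_eval_eq_on_circle {P Q : ℂ[X]} (h : ∀ z : ℂ, ‖z‖ = 1 → P.eval z = Q.eval z) :
    P = Q := by
  refine eq_of_infinite_eval_eq P Q (infinite_range_pt.mono ?_)
  rintro _ ⟨t, rfl⟩
  exact h _ (norm_pt t)

/-- `R + iS` is, up to a constant factor and a power of `z`, the reflection of `R - iS`. -/
theorem exists_add_I_mul_eq {R S : ℂ[X]} (hS : S ≠ 0)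
    (hRS : ∀ z : ℂ, ¬ (R.IsRoot z ∧ S.IsRoot z))
    (hreal : ∀ z : ℂ, ‖z‖ = 1 → S.eval z ≠ 0 → (R.eval z / S.eval z).im = 0) :
    ∃ (c : ℂ) (m : ℕ), c ≠ 0 ∧
      R + C Complex.I * S = C c * X ^ m * breve (R - C Complex.I * S) := by
  have hF0 : R - C Complex.I * S ≠ 0 := fun h =>
    eval_sub_I_mul_ne_zero hRS hreal norm_one (by rw [h, eval_zero])
  obtain ⟨a, ha, hFa⟩ := exists_conj_eval_eq hF0
  obtain ⟨b, hb, hSb⟩ := exists_conj_eval_eq hS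
  set d := (R - C Complex.I * S).natDegree
  -- Realness of `ω` gives `(R + iS) conj S = conj (R - iS) S` on the circle. Reflection turns the
  -- conjugates into polynomials, and the circle is infinite.
  have h1 : C b * breve S * (R + C Complex.I * S) * X ^ d
      = C a * breve (R - C Complex.I * S) * S * X ^ S.natDegree := by
    refine eq_of_eval_eq_on_circle fun z hz => ?_
    have h2 : (R + C Complex.I * S).eval z * conj (S.eval z)
        = conj ((R - C Complex.I * S).eval z) * S.eval z := by
      by_cases h0 : S.eval z = 0
      · rw [h0, map_zero, mul_zero, mul_zero]
      · have h3 := Complex.conj_eq_iff_im.2 (hreal z hz h0)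
        rw [map_div₀, div_eq_div_iff ((_root_.map_ne_zero conj).2 h0) h0] at h3
        simp only [eval_add, eval_sub, eval_mul, eval_C, map_sub, map_mul, Complex.conj_I]
        linear_combination -h3
    simp only [eval_mul, eval_C, eval_pow, eval_X]
    rw [← hSb z hz, ← hFa z hz]
    linear_combination z ^ d * z ^ S.natDegree * h2
  have hcop : IsCoprime S (R + C Complex.I * S) := by
    have : IsCoprime R S := by
      rw [Polynomial.isCoprime_iff_aeval_ne_zero_of_isAlgClosed ℂ ℂ]
      intro z
      simp only [coe_aeval_eq_eval, ← not_and_or]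
      exact fun hz => hRS z hz
    exact (this.add_mul_right_left _).symm
  -- The zero at the origin is split off because reflection discards it.
  obtain ⟨S₀, hS₀, hndvd⟩ := exists_eq_pow_rootMultiplicity_mul_and_not_dvd S hS 0
  set j := S.rootMultiplicity 0
  rw [C_0, sub_zero] at hS₀ hndvd
  have hS₀0 : S₀ ≠ 0 := fun h => hndvd (h ▸ dvd_zero X)
  have hS₀e : S₀.eval 0 ≠ 0 := fun h => hndvd (by rw [X_dvd_iff, coeff_zero_eq_eval_zero, h])
  have hbS : breve S = breve S₀ := by
    rw [hS₀, breve_mul (pow_ne_zero _ X_ne_zero) hS₀0, breve_X_pow, one_mul]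
  -- Since `S` is coprime to `R + iS`, the identity `h1` leaves `S₀` dividing its own reflection.
  -- The degrees agree, so the quotient is constant and `S₀` can be cancelled from `h1`.
  have hdvd : S₀ ∣ breve S₀ := by
    have h2 : S ∣ (R + C Complex.I * S) * (C b * X ^ d * breve S) :=
      ⟨C a * breve (R - C Complex.I * S) * X ^ S.natDegree, by linear_combination h1⟩
    have h3 : S₀ ∣ C b * X ^ d * breve S₀ := by
      rw [← hbS]
      exact (Dvd.intro_left _ hS₀.symm).trans (hcop.dvd_of_dvd_mul_left h2)
    refine IsCoprime.dvd_of_dvd_mul_left ?_ h3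
    refine IsCoprime.mul_right 
      ⟨0, C b⁻¹, by rw [zero_mul, zero_add, ← C_mul, inv_mul_cancel₀ hb, C_1]⟩ ?_
    exact IsCoprime.pow_right (((irreducible_X.coprime_iff_not_dvd).2 hndvd).symm)
  obtain ⟨w, hw⟩ := hdvd
  have hw0 : w ≠ 0 := fun h => (monic_breve S₀).ne_zero (by rw [hw, h, mul_zero])
  have hwd : w.natDegree = 0 := by
    have h2 := congr_arg natDegree hw
    rw [natDegree_breve hS₀0 hS₀e, natDegree_mul hS₀0 hw0] at h2
    lia
  obtain ⟨e, rfl⟩ := natDegree_eq_zero.1 hwd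
  have he : e ≠ 0 := fun h => hw0 (by rw [h, C_0])
  have h2 : C (b * e) * (R + C Complex.I * S) * X ^ d
      = C a * breve (R - C Complex.I * S) * X ^ (j + S.natDegree) := by
    refine mul_left_cancel₀ hS₀0 ?_
    have h3 : C b * breve S * (R + C Complex.I * S) * X ^ d
        = C a * breve (R - C Complex.I * S) * (X ^ j * S₀) * X ^ S.natDegree := by
      rw [← hS₀]
      exact h1
    rw [hbS, hw] at h3
    rw [C_mul, pow_add]
    linear_combination h3
  have hbe : b * e ≠ 0 := mul_ne_zero hb he
  rcases le_or_gt d (j + S.natDegree) with h3 | h3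
  · obtain ⟨m, hm⟩ := Nat.exists_eq_add_of_le h3
    refine ⟨a / (b * e), m, div_ne_zero ha hbe, ?_⟩
    refine mul_left_cancel₀ (mul_ne_zero (C_ne_zero.2 hbe) (pow_ne_zero d X_ne_zero)) ?_
    have h4 : C a = C (b * e) * C (a / (b * e)) := by rw [← C_mul, mul_div_cancel₀ _ hbe]
    rw [hm, pow_add, h4] at h2
    linear_combination h2
  -- In this case `z` would divide the reflection of `R - iS`, which does not vanish at `0`.
  · obtain ⟨m, hm⟩ := Nat.exists_eq_add_of_lt h3
    rw [hm] at h2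
    have h4 : C (b * e) * (R + C Complex.I * S) * X ^ (m + 1)
        = C a * breve (R - C Complex.I * S) := by
      refine mul_right_cancel₀ (pow_ne_zero (j + S.natDegree) X_ne_zero) ?_
      rw [← h2, mul_assoc, ← pow_add]
      congr 2
      lia
    have h5 := congr_arg (eval 0) h4
    simp [ha, eval_zero_breve_ne_zero] at h5

theorem polyMultiples_C_mul (A B : ℂ[X]) {d : ℂ} (hd : d ≠ 0) (n : ℤ) :
    polyMultiples A (C d * B) n = polyMultiples A B n := by
  ext f
  constructor
  · rintro ⟨t, ht, rfl⟩
    refine ⟨C d⁻¹ * t, ?_, ?_⟩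
    · rw [natDegree_C_mul (inv_ne_zero hd)]
      exact ht.imp_left fun h => by rw [h, mul_zero]
    · funext x
      simp only [ratFun, eval_mul, eval_C]
      field_simp
  · rintro ⟨t, ht, rfl⟩
    refine ⟨C d * t, ?_, ?_⟩
    · rw [natDegree_C_mul hd]
      exact ht.imp_left fun h => by rw [h, mul_zero]
    · funext x
      simp only [ratFun, eval_mul, eval_C]
      field_simp

end

end RationalToeplitz

/-! ### The theorem. -/

theorem mainTheorem3 (R S : ℂ[X]) (hS : S ≠ 0)
    (hRS : ∀ z : ℂ, ¬ (R.IsRoot z ∧ S.IsRoot z))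
    (hreal : ∀ z : ℂ, ‖z‖ = 1 → S.eval z ≠ 0 → (R.eval z / S.eval z).im = 0) :
    -- densely defined, closed, symmetric
    Dense ((toeplitz (ratFun R S)).domain : Set hardy) ∧
    (toeplitz (ratFun R S)).IsClosed ∧
    (toeplitz (ratFun R S)).IsFormalAdjoint (toeplitz (ratFun R S)) ∧
    -- the domain is `s H²`
    ConsistsOf (toeplitz (ratFun R S)).domain
      {f | ∃ h : hardy, f = fun t => (circlePart S).eval (pt t) * (h : L2T) t} ∧
    -- the range is `P ((R / (S_in S_ex)) H²)`
    ((toeplitz (ratFun R (inPart S * exPart S))).domain = ⊤ ∧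
      LinearMap.range (toeplitz (ratFun R S)).toFun =
        LinearMap.range (toeplitz (ratFun R (inPart S * exPart S))).toFun) ∧
    -- the factorization exists, and every such factorization yields the deficiency data
    (∃ p q : ℂ[X], IsFactorization R S p q) ∧
    ∀ (p q : ℂ[X]) (l : ℤ), IsFactorization R S p q →
      l = ((R + C Complex.I * S).natDegree : ℤ)
        - ((breve p).natDegree : ℤ) - ((breve q).natDegree : ℤ) →
      (FiniteDimensional ℂ (ranSub (toeplitz (ratFun R S)) Complex.I)ᗮ ∧
        (Module.finrank ℂ (ranSub (toeplitz (ratFun R S)) Complex.I)ᗮ : ℤ) =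
          (p.natDegree : ℤ) - ((inPart S).natDegree : ℤ)) ∧
      (FiniteDimensional ℂ (ranSub (toeplitz (ratFun R S)) (-Complex.I))ᗮ ∧
        (Module.finrank ℂ (ranSub (toeplitz (ratFun R S)) (-Complex.I))ᗮ : ℤ) =
          l + (q.natDegree : ℤ) - ((inPart S).natDegree : ℤ)) ∧
      ConsistsOf (ranSub (toeplitz (ratFun R S)) Complex.I)ᗮ
        (polyMultiples (exPart (breve S)) (breve p)
          ((p.natDegree : ℤ) - ((inPart S).natDegree : ℤ))) ∧
      ConsistsOf (ranSub (toeplitz (ratFun R S)) (-Complex.I))ᗮ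
        (polyMultiples (exPart (breve S)) q
          (l + (q.natDegree : ℤ) - ((inPart S).natDegree : ℤ))) := by
  have hreal' := ae_im_ratFun_eq_zero hS hreal
  refine ⟨dense_domain_toeplitz hS hRS, isClosed_toeplitz hS, isFormalAdjoint_toeplitz hreal',
    ⟨fun v hv => ?_, ?_⟩, ⟨domain_toeplitz_eq_top (norm_ne_one_of_isRoot_inPart_mul_exPart S), ?_⟩,
    exists_isFactorization hRS hreal, ?_⟩
  · obtain ⟨h, hh⟩ := (mem_domain_iff hS hRS v).1 hv
    exact ⟨_, ⟨h, rfl⟩, hh⟩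
  · rintro _ ⟨h, rfl⟩
    obtain ⟨u, hu⟩ := exists_hardy_pmul (circlePart S) h
    exact ⟨u, (mem_domain_iff hS hRS u).2 ⟨h, hu⟩, hu⟩
  -- The formula for the range is the case `c = 0` of the reduction.
  · have h := ranSub_toeplitz hS hRS 0
    rwa [ranSub, zero_smul, sub_zero, C_0, zero_mul, sub_zero] at h
  rintro p q l ⟨hpq, hp, hq⟩ hl
  have hF0 : p * q ≠ 0 := fun h =>
    eval_sub_I_mul_ne_zero hRS hreal norm_one (by rw [hpq, h, eval_zero])
  have hp0 := left_ne_zero_of_mul hF0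
  have hq0 := right_ne_zero_of_mul hF0
  have hqe : q.eval 0 ≠ 0 := fun h => (hq 0 h).not_ge (by simp)
  have hle := natDegree_inPart_le hS hRS hreal (c := Complex.I) (by simp) hpq hq0 hq
  obtain ⟨hdim, hker⟩ := orthogonal_range_toeplitz hp0 hq0 hp hq hle
    (K := (ranSub (toeplitz (ratFun R S)) Complex.I)ᗮ) (by rw [ranSub_toeplitz hS hRS, hpq])
  obtain ⟨c, m, hc, hcm⟩ := exists_add_I_mul_eq hS hRS hreal
  rw [hpq, breve_mul hp0 hq0] at hcm
  have hbp0 := (monic_breve p).ne_zero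
  have hbq0 := (monic_breve q).ne_zero
  have hX0 : C c * X ^ m ≠ 0 := mul_ne_zero (C_ne_zero.2 hc) (pow_ne_zero m X_ne_zero)
  have hp'0 : C c * X ^ m * breve q ≠ 0 := mul_ne_zero hX0 hbq0
  -- The number `l` is the multiplicity of the zero of `R + iS` at the origin, as the reflections do
  -- not vanish there.
  have hlm : l = m := by
    rw [hl, hcm, natDegree_mul hX0 (mul_ne_zero hbp0 hbq0), natDegree_mul hbp0 hbq0,
      natDegree_C_mul_X_pow m c hc]
    lia
  have hdeg : ((C c * X ^ m * breve q).natDegree : ℤ) = l + q.natDegree := by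
    rw [natDegree_mul hX0 hbq0, natDegree_C_mul_X_pow m c hc, natDegree_breve hq0 hqe, hlm]
    push_cast
    rfl
  -- For `-i` the roles of `p` and `q` are played by `c z^m q˘`, with zeros inside the disc, and
  -- `p˘`, with zeros outside.
  have hpq' : R - C (-Complex.I) * S = C c * X ^ m * breve q * breve p := by
    rw [C_neg, neg_mul, sub_neg_eq_add, hcm]
    ring
  have hp' : ∀ z, (C c * X ^ m * breve q).IsRoot z → ‖z‖ < 1 := by
    intro z hz
    rcases root_mul.1 hz with h | h
    · have h1 : z = 0 := by
        rw [IsRoot, eval_mul, eval_C, eval_pow, eval_X, mul_eq_zero, or_iff_right hc] at h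
        exact eq_zero_of_pow_eq_zero h
      rw [h1, norm_zero]
      exact one_pos
    · exact norm_lt_one_of_isRoot_breve hq z h
  have hq' := one_lt_norm_of_isRoot_breve hp
  have hle' := natDegree_inPart_le hS hRS hreal (c := -Complex.I) (by simp) hpq' hbp0 hq'
  obtain ⟨hdim', hker'⟩ := orthogonal_range_toeplitz hp'0 hbp0 hp' hq' hle'
    (K := (ranSub (toeplitz (ratFun R S)) (-Complex.I))ᗮ) (by rw [ranSub_toeplitz hS hRS, hpq'])
  rw [hdeg] at hdim' hker'
  obtain ⟨d, hd, hqd⟩ := breve_breve hq0 hqe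
  have hbb : breve (C c * X ^ m * breve q) = breve (breve q) := by
    rw [breve_mul hX0 hbq0, breve_mul (C_ne_zero.2 hc) (pow_ne_zero m X_ne_zero), breve_C,
      breve_X_pow, one_mul, one_mul]
  refine ⟨hdim, hdim', hker, ?_⟩
  -- The denominator is the double reflection of `q`, which is `q` up to a constant that the
  -- polynomial `t` absorbs.
  rw [hbb, ← polyMultiples_C_mul _ _ hd, ← hqd] at hker'
  exact hker'
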